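/- Fix positive integers $a_1,\dots,a_4$. A set $S$ of integers is a Sidon set if the only solutions of $x_1+x_2=x_3+x_4$ with $x_1,\dots,x_4\in S$ are the trivial ones, i.e. those with $(x_1,x_2)=(x_3,x_4)$ or $(x_1,x_2)=(x_4,x_3)$. For a positive integer $n$, let $M(n)$ be the maximum size of a Sidon set $S\subseteq[n]=\{1,2,\dots,n\}$ that contains no five pairwise distinct elements $x_1,\dots,x_5$ with $$a_1x_1+a_2x_2+a_3x_3+a_4x_4=(a_1+a_2+a_3+a_4)x_5 .$$ Then, as $n\to\infty$ with $a_1,\dots,a_4$ fixed, $M(n)=o(\sqrt n)$ and $M(n)\ge n^{1/2-o(1)}$; that is, $M(n)/\sqrt n\to 0$, and there is a sequence $\varepsilon(n)\to 0$ with $M(n)\ge n^{1/2-\varepsilon(n)}$ for all $n\ge 1$. (The case $a_1=\dots=a_4=1$ concerns the equation $x_1+x_2+x_3+x_4=4x_5$.) -/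

import Mathlib

open Filter Topology Asymptotics

/-- `S` is a Sidon set: every solution of `x₁ + x₂ = x₃ + x₄` in `S` is trivial, that is,
`(x₁, x₂)` equals `(x₃, x₄)` or `(x₄, x₃)`. -/
def IsSidonSet (S : Finset ℕ) : Prop :=
  ∀ x₁ ∈ S, ∀ x₂ ∈ S, ∀ x₃ ∈ S, ∀ x₄ ∈ S, x₁ + x₂ = x₃ + x₄ →
    (x₁ = x₃ ∧ x₂ = x₄) ∨ (x₁ = x₄ ∧ x₂ = x₃)

/-- `S` contains pairwise distinct `x₁, …, x₅` with
`a₁x₁ + a₂x₂ + a₃x₃ + a₄x₄ = (a₁ + a₂ + a₃ + a₄)x₅`. Indices start at `0` in the code. -/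
def HasDistinctSolution (a : Fin 4 → ℕ) (S : Finset ℕ) : Prop :=
  ∃ x : Fin 5 → ℕ, (∀ i, x i ∈ S) ∧ Function.Injective x ∧
    a 0 * x 0 + a 1 * x 1 + a 2 * x 2 + a 3 * x 3 = (a 0 + a 1 + a 2 + a 3) * x 4

open Classical in
/-- The Sidon subsets of `[n] = {1, …, n}` with no solution in distinct variables. -/
noncomputable def admissibleSets (a : Fin 4 → ℕ) (n : ℕ) : Finset (Finset ℕ) :=
  (Finset.Icc 1 n).powerset.filter fun S => IsSidonSet S ∧ ¬ HasDistinctSolution a S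

/-- The maximum size of a Sidon subset of `[n]` with no solution in distinct variables. -/
noncomputable def maxAdmissibleSize (a : Fin 4 → ℕ) (n : ℕ) : ℕ :=
  (admissibleSets a n).sup Finset.card

/-- The maximum is attained, as the empty set is admissible. -/
theorem maxAdmissibleSize_isGreatest (a : Fin 4 → ℕ) (n : ℕ) :
    IsGreatest {k : ℕ | ∃ S : Finset ℕ, S ⊆ Finset.Icc 1 n ∧ IsSidonSet S ∧
      ¬ HasDistinctSolution a S ∧ S.card = k} (maxAdmissibleSize a n) := by
  have hne : (admissibleSets a n).Nonempty :=
    ⟨∅, by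
      simp only [admissibleSets, Finset.mem_filter, Finset.mem_powerset]
      exact ⟨by simp, by simp [IsSidonSet], by simp [HasDistinctSolution]⟩⟩
  constructor
  · obtain ⟨S, hS, h⟩ := Finset.exists_mem_eq_sup _ hne Finset.card
    simp only [admissibleSets, Finset.mem_filter, Finset.mem_powerset] at hS
    exact ⟨S, hS.1, hS.2.1, hS.2.2, h.symm⟩
  · rintro k ⟨S, h1, h2, h3, rfl⟩
    refine Finset.le_sup (f := Finset.card) ?_
    simp only [admissibleSets, Finset.mem_filter, Finset.mem_powerset]
    exact ⟨h1, h2, h3⟩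

/-! Lower bound: Behrend's construction gives a solution-free set `B` of density `N^(-o(1))`, since
a weighted mean of points of a sphere, with positive weights, lies on the sphere only if they all
coincide. On average over translates, `B` meets a Sidon set of size about `√N` in `N^(1/2-o(1))`
points. The intersection is still Sidon, and it is solution-free because the equation is
translation-invariant (`card_mul_card_le_maxAdmissibleSize`, `le_maxAdmissibleSize_of_pow`).

Upper bound: let `S` be Sidon with `|S| ≥ δ√n`, viewed in `ZMod p` with `p` of order `n`. The Sidon
property bounds the fourth moment of the Fourier transform of `S`, so only boundedly many
frequencies are large. Averaging the indicator of `S` over a Bohr set of these frequencies changes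
the transform little in sup norm. In a count with five variables one factor absorbs this change and
the other four are controlled by the fourth moment, so the count moves by a small multiple of
`p^(3/2)`. Distinct translates of `S` share at most one point, so the averaged function has bounded
square sum. As its sum is `|S|`, Cauchy–Schwarz makes it at least a constant times `δ/√p` on a set
of positive density. That set contains a constant times `p^4` solutions by triangle removal
(`fiveTermDensity_le_card`), hence `S` contains a constant times `p^(3/2)`
(`IsSidonIn.exists_le_card_linearSolutions`). Only `O(p)` of these repeat a variable, because
merging two variables leaves a four-variable equation with at most `2|S|²` solutions
(`IsSidonIn.card_not_injective_le`). -/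

section LowerBound

/-! ### Lower bound: Sidon sets intersected with Behrend sets -/

/-- The Erdős–Turán set `{2pk + (k² mod p) : k < p}`. -/
def erdosTuranSet (p : ℕ) : Finset ℕ :=
  (Finset.range p).image fun k => 2 * p * k + k ^ 2 % p

theorem card_erdosTuranSet {p : ℕ} : (erdosTuranSet p).card = p := by
  rw [erdosTuranSet, Finset.card_image_of_injOn, Finset.card_range]
  intro k hk l hl h
  have hk' : k < p := by simpa using hk
  have hp : 0 < p := by omega
  have h1 := Nat.mod_lt (k ^ 2) hp
  have h2 := Nat.mod_lt (l ^ 2) hp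
  have h3 := congrArg (· / (2 * p)) h
  simp only at h3
  rwa [Nat.mul_add_div (by omega), Nat.mul_add_div (by omega), Nat.div_eq_of_lt (by omega),
    Nat.div_eq_of_lt (by omega)] at h3

theorem lt_of_mem_erdosTuranSet {p s : ℕ} (hs : s ∈ erdosTuranSet p) : s < 2 * p ^ 2 := by
  obtain ⟨k, hk, rfl⟩ := Finset.mem_image.1 hs
  have hk' : k < p := by simpa using hk
  have h1 := Nat.mod_lt (k ^ 2) (show 0 < p by omega)
  nlinarith

/-- Two residues sum to less than `2p`, so division by `2p` separates `k₁ + k₂` from the sum of the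
residues. The sum and the sum of squares modulo an odd prime determine the pair. -/
theorem isSidonSet_erdosTuranSet {p : ℕ} (hp : p.Prime) (hp2 : p ≠ 2) :
    IsSidonSet (erdosTuranSet p) := by
  intro x₁ h₁ x₂ h₂ x₃ h₃ x₄ h₄ h
  obtain ⟨k₁, hk₁, rfl⟩ := Finset.mem_image.1 h₁
  obtain ⟨k₂, hk₂, rfl⟩ := Finset.mem_image.1 h₂
  obtain ⟨k₃, hk₃, rfl⟩ := Finset.mem_image.1 h₃
  obtain ⟨k₄, hk₄, rfl⟩ := Finset.mem_image.1 h₄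
  rw [Finset.mem_range] at hk₁ hk₂ hk₃ hk₄
  have m₁ := Nat.mod_lt (k₁ ^ 2) hp.pos
  have m₂ := Nat.mod_lt (k₂ ^ 2) hp.pos
  have m₃ := Nat.mod_lt (k₃ ^ 2) hp.pos
  have m₄ := Nat.mod_lt (k₄ ^ 2) hp.pos
  have h' : 2 * p * (k₁ + k₂) + (k₁ ^ 2 % p + k₂ ^ 2 % p) =
      2 * p * (k₃ + k₄) + (k₃ ^ 2 % p + k₄ ^ 2 % p) := by linarith
  have hlin : k₁ + k₂ = k₃ + k₄ := by
    have h3 : _ / (2 * p) = _ / (2 * p) := congrArg (· / (2 * p)) h'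
    rwa [Nat.mul_add_div (by omega), Nat.mul_add_div (by omega), Nat.div_eq_of_lt (by omega),
      Nat.div_eq_of_lt (by omega)] at h3
  have hsq : k₁ ^ 2 % p + k₂ ^ 2 % p = k₃ ^ 2 % p + k₄ ^ 2 % p := by
    rw [hlin] at h'
    exact Nat.add_left_cancel h'
  have : Fact p.Prime := ⟨hp⟩
  have hlinF : (k₁ : ZMod p) + k₂ = k₃ + k₄ := by 
    exact_mod_cast congrArg (Nat.cast (R := ZMod p)) hlin
  have hsqF : (k₁ : ZMod p) ^ 2 + k₂ ^ 2 = k₃ ^ 2 + k₄ ^ 2 := by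
    have := congrArg (Nat.cast (R := ZMod p)) hsq
    simpa using this
  have h2 : (2 : ZMod p) ≠ 0 := by
    intro h
    have h' : ((2 : ℕ) : ZMod p) = 0 := by exact_mod_cast h
    rw [ZMod.natCast_eq_zero_iff] at h'
    exact hp2 ((Nat.prime_dvd_prime_iff_eq hp Nat.prime_two).1 h')
  have hcast : ∀ {k l : ℕ}, k < p → l < p → (k : ZMod p) = l → k = l := by
    intro k l hk hl e
    rw [ZMod.natCast_eq_natCast_iff'] at e
    rwa [Nat.mod_eq_of_lt hk, Nat.mod_eq_of_lt hl] at e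
  have hprod : (2 : ZMod p) * (((k₁ : ZMod p) - k₃) * (k₂ - k₃)) = 0 := by
    linear_combination ((k₁ : ZMod p) + k₂ - k₃ + k₄) * hlinF - hsqF
  rcases mul_eq_zero.1 ((mul_eq_zero.1 hprod).resolve_left h2) with h0 | h0
  · obtain rfl := hcast hk₁ hk₃ (sub_eq_zero.1 h0)
    obtain rfl : k₂ = k₄ := by omega
    exact Or.inl ⟨rfl, rfl⟩
  · obtain rfl := hcast hk₂ hk₃ (sub_eq_zero.1 h0)
    obtain rfl : k₁ = k₄ := by omega
    exact Or.inr ⟨rfl, rfl⟩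

theorem le_maxAdmissibleSize {a : Fin 4 → ℕ} {n : ℕ} {S : Finset ℕ} (h₁ : S ⊆ Finset.Icc 1 n)
    (h₂ : IsSidonSet S) (h₃ : ¬ HasDistinctSolution a S) : S.card ≤ maxAdmissibleSize a n :=
  (maxAdmissibleSize_isGreatest a n).2 ⟨S, h₁, h₂, h₃, rfl⟩

theorem maxAdmissibleSize_mono (a : Fin 4 → ℕ) : Monotone (maxAdmissibleSize a) := by
  intro m n hmn
  obtain ⟨S, h₁, h₂, h₃, h⟩ := (maxAdmissibleSize_isGreatest a m).1
  rw [← h]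
  exact le_maxAdmissibleSize (h₁.trans (Finset.Icc_subset_Icc_right hmn)) h₂ h₃

/-- A translate of a solution-free set meets a Sidon set in at least the average size. -/
theorem card_mul_card_le_maxAdmissibleSize {a : Fin 4 → ℕ} {S B : Finset ℕ} {N L : ℕ}
    (hSN : ∀ s ∈ S, s < N) (hBL : ∀ b ∈ B, b < L) (hS : IsSidonSet S)
    (hB : ¬ HasDistinctSolution a B) :
    S.card * B.card ≤ (N + L) * maxAdmissibleSize a N := by
  have hmap : ∀ u ∈ S ×ˢ B, N + u.2 - u.1 ∈ Finset.range (N + L) := by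
    rintro ⟨s, b⟩ h
    obtain ⟨hs, hb⟩ := Finset.mem_product.1 h
    have := hSN s hs
    have := hBL b hb
    simp only [Finset.mem_range]
    simp only at *
    omega
  rw [← Finset.card_product, Finset.card_eq_sum_card_fiberwise hmap]
  refine (Finset.sum_le_card_nsmul _ _ (maxAdmissibleSize a N) ?_).trans (by simp)
  intro t _
  -- The fibre over `t` is the intersection of `S` with `B + (N - t)`; adding 1 moves it from `[0,
  -- N)` into `[1, N]`.
  set T := ((S ×ˢ B).filter fun u => N + u.2 - u.1 = t).image fun u => u.1 + 1 with hT
  have hmemT : ∀ x ∈ T, ∃ s ∈ S, ∃ b ∈ B, x = s + 1 ∧ N + b = t + s := by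
    intro x hx
    obtain ⟨⟨s, b⟩, hu, rfl⟩ := Finset.mem_image.1 hx
    obtain ⟨hu, e⟩ := Finset.mem_filter.1 hu
    obtain ⟨hs, hb⟩ := Finset.mem_product.1 hu
    have := hSN s hs
    exact ⟨s, hs, b, hb, rfl, by simp only at *; omega⟩
  have hcard : T.card = ((S ×ˢ B).filter fun u => N + u.2 - u.1 = t).card := by
    refine Finset.card_image_of_injOn ?_
    rintro ⟨s, b⟩ h ⟨s', b'⟩ h' heq
    simp only [Finset.coe_filter, Set.mem_ofPred_eq, Finset.mem_product] at h h' heq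
    have := hSN s h.1.1
    have := hSN s' h'.1.1
    simp only [Prod.mk.injEq]
    omega
  rw [← hcard]
  refine le_maxAdmissibleSize ?_ ?_ ?_
  · intro x hx
    obtain ⟨s, hs, b, -, rfl, -⟩ := hmemT x hx
    have := hSN s hs
    rw [Finset.mem_Icc]
    omega
  · intro x₁ h₁ x₂ h₂ x₃ h₃ x₄ h₄ h
    obtain ⟨s₁, hs₁, -, -, rfl, -⟩ := hmemT x₁ h₁
    obtain ⟨s₂, hs₂, -, -, rfl, -⟩ := hmemT x₂ h₂
    obtain ⟨s₃, hs₃, -, -, rfl, -⟩ := hmemT x₃ h₃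
    obtain ⟨s₄, hs₄, -, -, rfl, -⟩ := hmemT x₄ h₄
    have := hS s₁ hs₁ s₂ hs₂ s₃ hs₃ s₄ hs₄ (by omega)
    omega
  · rintro ⟨x, hx, hinj, heq⟩
    choose s hs b hb hxs hbs using fun i => hmemT (x i) (hx i)
    refine hB ⟨b, hb, fun i j hij => hinj ?_, ?_⟩
    · have := hbs i
      have := hbs j
      rw [hxs, hxs]
      omega
    · have hb' : ∀ i, (b i : ℤ) = x i + (t - 1 - N : ℤ) := by
        intro i
        have := hbs i
        have := hxs i
        omega
      zify at heq ⊢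
      simp only [hb']
      linear_combination heq

/-- Points of a sphere, read as digits in a base large enough to prevent carries. -/
theorem not_hasDistinctSolution_image_sphere {a : Fin 4 → ℕ} (ha : ∀ i, 0 < a i) (d m k : ℕ) :
    ¬ HasDistinctSolution a ((Behrend.sphere d m k).image
      (Behrend.map ((a 0 + a 1 + a 2 + a 3) * m))) := by
  rintro ⟨x, hx, hinj, heq⟩
  choose v hv hvx using fun i => Finset.mem_image.1 (hx i)
  set A := a 0 + a 1 + a 2 + a 3 with hA
  have hlt : ∀ i j, v i j < m := fun i =>
    Behrend.mem_box.1 (Behrend.sphere_subset_box (hv i))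
  have hsq : ∀ i, ∑ j, (v i j : ℤ) ^ 2 = k := by
    intro i
    exact_mod_cast (Finset.mem_filter.1 (hv i)).2
  have hvec : a 0 • v 0 + a 1 • v 1 + a 2 • v 2 + a 3 • v 3 = A • v 4 := by
    apply Behrend.map_injOn (d := A * m)
    · intro j
      have h0 := hlt 0 j
      have h1 := hlt 1 j
      have h2 := hlt 2 j
      have h3 := hlt 3 j
      simp only [Pi.add_apply, Pi.smul_apply, smul_eq_mul]
      have e0 := Nat.mul_lt_mul_of_pos_left h0 (ha 0)
      have e1 := Nat.mul_lt_mul_of_pos_left h1 (ha 1)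
      have e2 := Nat.mul_lt_mul_of_pos_left h2 (ha 2)
      have e3 := Nat.mul_lt_mul_of_pos_left h3 (ha 3)
      rw [hA]
      nlinarith
    · intro j
      simp only [Pi.smul_apply, smul_eq_mul]
      exact Nat.mul_lt_mul_of_pos_left (hlt 4 j) (by have := ha 0; omega)
    · simp only [map_add, map_nsmul, smul_eq_mul, hvx]
      exact heq
  have hcoord : ∀ j, (a 0 * v 0 j + a 1 * v 1 j + a 2 * v 2 j + a 3 * v 3 j : ℤ) =
      (a 0 + a 1 + a 2 + a 3 : ℤ) * v 4 j := by
    intro j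
    have := congrFun hvec j
    simp only [Pi.add_apply, Pi.smul_apply, smul_eq_mul] at this
    rw [hA] at this
    exact_mod_cast this
  -- The weighted variance about the mean `v 4` is `∑ aᵢ|vᵢ|² - A|v₄|²`, which vanishes on a sphere.
  have hzero : ∑ j, ((a 0 : ℤ) * (v 0 j - v 4 j) ^ 2 + a 1 * (v 1 j - v 4 j) ^ 2 +
      a 2 * (v 2 j - v 4 j) ^ 2 + a 3 * (v 3 j - v 4 j) ^ 2) = 0 := by
    have : ∀ j, ((a 0 : ℤ) * (v 0 j - v 4 j) ^ 2 + a 1 * (v 1 j - v 4 j) ^ 2 +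
        a 2 * (v 2 j - v 4 j) ^ 2 + a 3 * (v 3 j - v 4 j) ^ 2) =
        a 0 * (v 0 j : ℤ) ^ 2 + a 1 * (v 1 j : ℤ) ^ 2 + a 2 * (v 2 j : ℤ) ^ 2 +
        a 3 * (v 3 j : ℤ) ^ 2 - (a 0 + a 1 + a 2 + a 3) * (v 4 j : ℤ) ^ 2 := by
      intro j
      linear_combination (-2 * (v 4 j : ℤ)) * hcoord j
    simp only [this, Finset.sum_sub_distrib, Finset.sum_add_distrib, ← Finset.mul_sum, hsq]
    ring
  have hnonneg : ∀ j ∈ Finset.univ, 0 ≤ ((a 0 : ℤ) * (v 0 j - v 4 j) ^ 2 +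
      a 1 * (v 1 j - v 4 j) ^ 2 + a 2 * (v 2 j - v 4 j) ^ 2 + a 3 * (v 3 j - v 4 j) ^ 2) :=
    fun j _ => by positivity
  have hv04 : v 0 = v 4 := by
    funext j
    have h := (Finset.sum_eq_zero_iff_of_nonneg hnonneg).1 hzero j (Finset.mem_univ j)
    have h0 : (a 0 : ℤ) * (v 0 j - v 4 j) ^ 2 ≤ 0 := by
      have h1 : (0 : ℤ) ≤ a 1 * (v 1 j - v 4 j) ^ 2 := by positivity
      have h2 : (0 : ℤ) ≤ a 2 * (v 2 j - v 4 j) ^ 2 := by positivity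
      have h3 : (0 : ℤ) ≤ a 3 * (v 3 j - v 4 j) ^ 2 := by positivity
      linarith
    have h1 : ((v 0 j : ℤ) - v 4 j) ^ 2 ≤ 0 :=
      nonpos_of_mul_nonpos_right h0 (by exact_mod_cast ha 0)
    have h2 : (v 0 j : ℤ) - v 4 j = 0 := by
      have := le_antisymm h1 (sq_nonneg _)
      simpa using this
    omega
  have : (0 : Fin 5) = 4 := hinj (by rw [← hvx, ← hvx, hv04])
  exact absurd this (by decide)

theorem map_lt_pow {d K : ℕ} {x : Fin d → ℕ} (hx : ∀ i, x i < K) : Behrend.map K x < K ^ d := by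
  induction d with
  | zero => simp [Behrend.map]
  | succ d ih =>
    rw [Behrend.map_succ']
    have h1 := ih (x := x ∘ Fin.succ) fun i => hx _
    have h0 := hx 0
    rw [pow_succ]
    nlinarith

/-- In dimension `2e` the digit box has side length `q²` with `q = (Am)^e`, matching an Erdős–Turán
set with `q < p ≤ 2q`. The loss against the square root is `m²` up to a factor depending on `e` and
`A`. -/
theorem le_maxAdmissibleSize_of_pow {a : Fin 4 → ℕ} (ha : ∀ i, 0 < a i) {e m : ℕ} (he : 0 < e)
    (hm : 0 < m) :
    (m : ℝ) ^ e ≤ 20 * e * (a 0 + a 1 + a 2 + a 3 : ℕ) ^ e * (m : ℝ) ^ 2 *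
      maxAdmissibleSize a (8 * ((a 0 + a 1 + a 2 + a 3) * m) ^ (2 * e)) := by
  set A := a 0 + a 1 + a 2 + a 3 with hA
  set q := (A * m) ^ e with hq
  have hA4 : 4 ≤ A := by
    have := ha 0; have := ha 1; have := ha 2; have := ha 3
    omega
  have hAm : 4 ≤ A * m := hA4.trans (Nat.le_mul_of_pos_right _ hm)
  have hq4 : 4 ≤ q := hAm.trans (Nat.le_self_pow he.ne' _)
  obtain ⟨p, hp, hqp, hp2q⟩ := Nat.exists_prime_lt_and_le_two_mul q (by omega)
  obtain ⟨k, hk⟩ := Behrend.exists_large_sphere (2 * e) m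
  set B := (Behrend.sphere (2 * e) m k).image (Behrend.map (A * m)) with hB
  have hlt : ∀ x ∈ Behrend.sphere (2 * e) m k, ∀ i, x i < A * m := fun x hx i =>
    (Behrend.mem_box.1 (Behrend.sphere_subset_box hx) i).trans_le
      (Nat.le_mul_of_pos_left _ (by omega))
  have hBcard : B.card = (Behrend.sphere (2 * e) m k).card :=
    Finset.card_image_of_injOn (Behrend.map_injOn.mono fun x hx => hlt x hx)
  have hBL : ∀ b ∈ B, b < q ^ 2 := by
    intro b hb
    obtain ⟨x, hx, rfl⟩ := Finset.mem_image.1 hb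
    rw [hq, ← pow_mul, mul_comm e 2]
    exact map_lt_pow (hlt x hx)
  have hmain := card_mul_card_le_maxAdmissibleSize
    (fun s hs => lt_of_mem_erdosTuranSet hs) hBL
    (isSidonSet_erdosTuranSet hp (by omega)) (not_hasDistinctSolution_image_sphere ha (2 * e) m k)
  rw [card_erdosTuranSet, hBcard] at hmain
  have hmono : maxAdmissibleSize a (2 * p ^ 2) ≤
      maxAdmissibleSize a (8 * (A * m) ^ (2 * e)) := by
    apply maxAdmissibleSize_mono
    rw [mul_comm 2 e, pow_mul, ← hq]
    nlinarith
  set M := maxAdmissibleSize a (8 * (A * m) ^ (2 * e))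
  have h2 : (p : ℝ) * (Behrend.sphere (2 * e) m k).card ≤ (2 * p ^ 2 + q ^ 2) * M := by
    have : p * (Behrend.sphere (2 * e) m k).card ≤ (2 * p ^ 2 + q ^ 2) * M :=
      hmain.trans (Nat.mul_le_mul_left _ hmono)
    exact_mod_cast this
  have hqpR : (q : ℝ) < p := by exact_mod_cast hqp
  have hp2qR : (p : ℝ) ≤ 2 * q := by exact_mod_cast hp2q
  have hq0 : (0 : ℝ) < q := by positivity
  have hm0 : (0 : ℝ) < m := by exact_mod_cast hm
  have he0 : (0 : ℝ) < e := by exact_mod_cast he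
  have hM0 : (0 : ℝ) ≤ M := by positivity
  have h3 : ((Behrend.sphere (2 * e) m k).card : ℝ) ≤ 5 * p * M := by
    refine le_of_mul_le_mul_left ?_ (hq0.trans hqpR)
    refine h2.trans ?_
    have : (2 * (p : ℝ) ^ 2 + q ^ 2) ≤ p * (5 * p) := by nlinarith
    calc _ ≤ p * (5 * p) * (M : ℝ) := mul_le_mul_of_nonneg_right this hM0
      _ = _ := by ring
  have h4 : (m : ℝ) ^ (2 * e) ≤ (5 * p * M) * (2 * e * m ^ 2) := by
    push_cast at hk
    rw [div_le_iff₀ (by positivity)] at hk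
    exact hk.trans (mul_le_mul_of_nonneg_right h3 (by positivity))
  have h5 : (m : ℝ) ^ (2 * e) ≤ (10 * q * M) * (2 * e * m ^ 2) := by
    refine h4.trans (mul_le_mul_of_nonneg_right (mul_le_mul_of_nonneg_right ?_ hM0)
      (by positivity))
    linarith
  have hme : (0 : ℝ) < (m : ℝ) ^ e := by positivity
  refine le_of_mul_le_mul_left ?_ hme
  calc (m : ℝ) ^ e * m ^ e = m ^ (2 * e) := by ring
    _ ≤ _ := h5
    _ = _ := by rw [hq]; push_cast; rw [mul_pow]; ring

theorem one_le_maxAdmissibleSize (a : Fin 4 → ℕ) {n : ℕ} (hn : 1 ≤ n) :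
    1 ≤ maxAdmissibleSize a n := by
  refine le_maxAdmissibleSize (S := {1}) (by simpa using hn) ?_ ?_
  · intro x₁ h₁ x₂ h₂ x₃ h₃ x₄ h₄ _
    simp only [Finset.mem_singleton] at *
    omega
  · rintro ⟨x, hx, hinj, -⟩
    have h : (0 : Fin 5) = 1 := hinj (by rw [Finset.mem_singleton.1 (hx 0),
      Finset.mem_singleton.1 (hx 1)])
    exact absurd h (by decide)

theorem eventually_rpow_le_maxAdmissibleSize {a : Fin 4 → ℕ} (ha : ∀ i, 0 < a i) {δ : ℝ}
    (hδ : 0 < δ) :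
    ∀ᶠ n : ℕ in atTop, (n : ℝ) ^ ((1 : ℝ) / 2 - δ) ≤ (maxAdmissibleSize a n : ℝ) := by
  set A := a 0 + a 1 + a 2 + a 3 with hA
  have hA1 : 1 ≤ A := by have := ha 0; omega
  -- This choice gives `m^4 ≤ n^δ`: two powers of `m` pay for the loss `m²`, the other two for the
  -- constant `C`.
  set e := ⌈2 / δ⌉₊ with he
  have he0 : 0 < e := Nat.ceil_pos.2 (by positivity)
  have heδ : 4 ≤ 2 * (e : ℝ) * δ := by
    have := Nat.le_ceil (2 / δ)
    rw [div_le_iff₀ hδ] at this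
    linarith
  set C : ℝ := 3 * (2 * A) ^ e * (20 * e * A ^ e) with hC
  set m₀ := ⌈C⌉₊ + 1 with hm₀
  filter_upwards [eventually_ge_atTop (8 * (A * m₀) ^ (2 * e))] with n hn
  have hself : ∀ k, k ≤ 8 * (A * k) ^ (2 * e) := fun k =>
    calc k ≤ A * k := Nat.le_mul_of_pos_left _ hA1
      _ ≤ (A * k) ^ (2 * e) := Nat.le_self_pow (by omega) _
      _ ≤ _ := Nat.le_mul_of_pos_left _ (by norm_num)
  -- Maximality of `m` makes `n` comparable to `(Am)^(2e)`, since `m + 1 ≤ 2m`.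
  set m := Nat.findGreatest (fun k => 8 * (A * k) ^ (2 * e) ≤ n) n with hm
  have hm₀m : m₀ ≤ m := Nat.le_findGreatest ((hself m₀).trans hn) hn
  have hmn : 8 * (A * m) ^ (2 * e) ≤ n :=
    Nat.findGreatest_spec (P := fun k => 8 * (A * k) ^ (2 * e) ≤ n) ((hself m₀).trans hn) hn
  have hnm : n < 8 * (A * (m + 1)) ^ (2 * e) := by
    by_contra! h
    have : m + 1 ≤ m := Nat.le_findGreatest ((hself _).trans h) h
    omega
  have hm1 : 1 ≤ m := by omega
  have hbound := le_maxAdmissibleSize_of_pow ha he0 hm1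
  rw [← hA] at hbound
  have hM : (maxAdmissibleSize a (8 * (A * m) ^ (2 * e)) : ℝ) ≤ maxAdmissibleSize a n := by
    exact_mod_cast maxAdmissibleSize_mono a hmn
  set M := (maxAdmissibleSize a n : ℝ)
  have hm1R : (1 : ℝ) ≤ m := by exact_mod_cast hm1
  have hA1R : (1 : ℝ) ≤ A := by exact_mod_cast hA1
  have hmC : C ≤ m := by
    have h1 := Nat.le_ceil C
    have h2 : (⌈C⌉₊ : ℝ) ≤ m := by exact_mod_cast (show ⌈C⌉₊ ≤ m by omega)
    linarith
  have hn0 : (0 : ℝ) < n := by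
    exact_mod_cast (show 0 < n from hm1.trans ((hself m).trans hmn))
  have hsqrt : (n : ℝ) ^ ((1 : ℝ) / 2) ≤ 3 * (2 * A) ^ e * m ^ e := by
    rw [← Real.sqrt_eq_rpow]
    refine Real.sqrt_le_iff.2 ⟨by positivity, ?_⟩
    have h1 : (n : ℝ) ≤ 8 * (A * (m + 1)) ^ (2 * e) := by exact_mod_cast hnm.le
    have h2 : ((A : ℝ) * (m + 1)) ^ (2 * e) ≤ (2 * A * m) ^ (2 * e) := by
      refine pow_le_pow_left₀ (by positivity) ?_ _
      nlinarith
    -- The factor 8 is raised to the perfect square 9.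
    calc (n : ℝ) ≤ 9 * (2 * A * m) ^ (2 * e) := by
          have : (0 : ℝ) ≤ (2 * A * m) ^ (2 * e) := by positivity
          linarith
      _ = _ := by rw [pow_mul', mul_pow (2 * (A : ℝ))]; ring
  have hpow : (m : ℝ) ^ 4 ≤ (n : ℝ) ^ δ := by
    have h1 : (m : ℝ) ^ (2 * e) ≤ n := by
      have : m ^ (2 * e) ≤ n :=
        calc m ^ (2 * e) ≤ (A * m) ^ (2 * e) :=
              Nat.pow_le_pow_left (Nat.le_mul_of_pos_left _ hA1) _
          _ ≤ 8 * (A * m) ^ (2 * e) := Nat.le_mul_of_pos_left _ (by norm_num)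
          _ ≤ n := hmn
      exact_mod_cast this
    calc (m : ℝ) ^ 4 = (m : ℝ) ^ (4 : ℝ) := by norm_cast
      _ ≤ (m : ℝ) ^ (2 * (e : ℝ) * δ) := Real.rpow_le_rpow_of_exponent_le hm1R heδ
      _ = ((m : ℝ) ^ (2 * e)) ^ δ := by
          rw [Real.rpow_mul (by positivity), ← Real.rpow_natCast]
          push_cast
          rfl
      _ ≤ _ := Real.rpow_le_rpow (by positivity) h1 hδ.le
  rw [Real.rpow_sub hn0, div_le_iff₀ (by positivity)]
  have hM0 : 0 ≤ M := by positivity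
  calc (n : ℝ) ^ ((1 : ℝ) / 2) ≤ 3 * (2 * A) ^ e * m ^ e := hsqrt
    _ ≤ 3 * (2 * A) ^ e * (20 * e * A ^ e * m ^ 2 * M) := by
        refine mul_le_mul_of_nonneg_left (hbound.trans ?_) (by positivity)
        exact mul_le_mul_of_nonneg_left hM (by positivity)
    _ = C * (m ^ 2 * M) := by rw [hC]; ring
    _ ≤ m ^ 2 * (m ^ 2 * M) := by
        refine mul_le_mul_of_nonneg_right (hmC.trans ?_) (by positivity)
        nlinarith
    _ = M * m ^ 4 := by ring
    _ ≤ M * (n : ℝ) ^ δ := mul_le_mul_of_nonneg_left hpow hM0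

theorem exists_exponent_maxAdmissibleSize {a : Fin 4 → ℕ} (ha : ∀ i, 0 < a i) :
    ∃ ε : ℕ → ℝ, Tendsto ε atTop (𝓝 0) ∧
      ∀ n : ℕ, 1 ≤ n → (n : ℝ) ^ ((1 : ℝ) / 2 - ε n) ≤ (maxAdmissibleSize a n : ℝ) := by
  -- The exact deficit of the exponent, truncated at 0. At `n = 1` the quotient by `log 1 = 0` is 0,
  -- which is harmless.
  refine ⟨fun n => max 0 (1 / 2 - Real.log (maxAdmissibleSize a n) / Real.log n), ?_, ?_⟩
  · rw [Metric.tendsto_atTop]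
    intro δ hδ
    obtain ⟨N, hN⟩ := eventually_atTop.1 ((eventually_rpow_le_maxAdmissibleSize ha
      (half_pos hδ)).and (eventually_ge_atTop 2))
    refine ⟨N, fun n hn => ?_⟩
    obtain ⟨h, hn2⟩ := hN n hn
    have hn0 : (0 : ℝ) < n := by positivity
    have hlog : 0 < Real.log n := Real.log_pos (by exact_mod_cast hn2)
    have h' := Real.log_le_log (by positivity) h
    rw [Real.log_rpow hn0, ← le_div_iff₀ hlog] at h'
    rw [Real.dist_eq, sub_zero, abs_of_nonneg (le_max_left _ _)]
    exact max_lt hδ (by linarith)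
  · intro n hn
    have hM : (1 : ℝ) ≤ maxAdmissibleSize a n := by exact_mod_cast one_le_maxAdmissibleSize a hn
    rcases hn.eq_or_lt with rfl | hn2
    · simpa using hM
    · have hlog : 0 < Real.log n := Real.log_pos (by exact_mod_cast hn2)
      have hn1 : (1 : ℝ) ≤ n := by exact_mod_cast hn
      calc (n : ℝ) ^ ((1 : ℝ) / 2 - max 0 (1 / 2 - Real.log (maxAdmissibleSize a n) / Real.log n))
          ≤ (n : ℝ) ^ (Real.log (maxAdmissibleSize a n) / Real.log n) := by
            refine Real.rpow_le_rpow_of_exponent_le hn1 ?_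
            have := le_max_right 0 (1 / 2 - Real.log (maxAdmissibleSize a n) / Real.log n)
            linarith
        _ = maxAdmissibleSize a n := by
            rw [Real.rpow_def_of_pos (by positivity), mul_div_cancel₀ _ hlog.ne',
              Real.exp_log (by positivity)]

end LowerBound

/-! ### Supersaturation in dense sets, from triangle removal -/

section Supersaturation

variable {F : Type} [Field F] [Fintype F] [DecidableEq F]

/-- The solutions of `b₁x + b₂y = (b₁ + b₂)z` in `D`. -/
def threeTermSolutions (b₁ b₂ : F) (D : Finset F) : Finset (F × F × F) :=
  (D ×ˢ D ×ˢ D).filter fun w => b₁ * w.1 + b₂ * w.2.1 = (b₁ + b₂) * w.2.2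

/-- The density of solutions of a three-term equation guaranteed in sets of density `ε`. -/
noncomputable def threeTermDensity (ε : ℝ) : ℝ :=
  27 * SimpleGraph.triangleRemovalBound (ε / 9)

theorem threeTermDensity_pos {ε : ℝ} (hε : 0 < ε) : 0 < threeTermDensity ε :=
  mul_pos (by norm_num) (SimpleGraph.triangleRemovalBound_pos (by positivity))

-- The Ruzsa–Szemerédi argument: each `x` and each `w ∈ D` give a triangle on three copies of `F`.
-- These triangles are edge-disjoint because `b₁`, `b₂`, `b₁ + b₂` are nonzero, so removal produces
-- many triangles, each encoding a solution.
open SimpleGraph.TripartiteFromTriangles in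
theorem threeTermDensity_le_card {b₁ b₂ : F} (h₁ : b₁ ≠ 0) (h₂ : b₂ ≠ 0) (h₁₂ : b₁ + b₂ ≠ 0)
    {D : Finset F} {ε : ℝ} (hD : ε * Fintype.card F ≤ D.card) :
    threeTermDensity ε * (Fintype.card F : ℝ) ^ 2 ≤ (threeTermSolutions b₁ b₂ D).card := by
  set t : Finset (F × F × F) := (Finset.univ ×ˢ D).image
    fun u : F × F => (u.1, u.1 + b₁ * u.2, u.1 + (b₁ + b₂) * u.2) with ht
  have hmem : ∀ x y z, (x, y, z) ∈ t ↔ ∃ w ∈ D, y = x + b₁ * w ∧ z = x + (b₁ + b₂) * w := by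
    intro x y z
    simp only [ht, Finset.mem_image, Finset.mem_product, Finset.mem_univ, true_and, Prod.exists,
      Prod.mk.injEq]
    constructor
    · rintro ⟨x, w, hw, rfl, rfl, rfl⟩
      exact ⟨w, hw, rfl, rfl⟩
    · rintro ⟨w, hw, rfl, rfl⟩
      exact ⟨x, w, hw, rfl, rfl, rfl⟩
  have htcard : t.card = Fintype.card F * D.card := by
    rw [ht, Finset.card_image_of_injective, Finset.card_product, Finset.card_univ]
    rintro ⟨x, w⟩ ⟨x', w'⟩ h
    simp only [Prod.mk.injEq] at h
    obtain ⟨rfl, h, -⟩ := h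
    simpa [h₁] using h
  have hdisj : ExplicitDisjoint t := by
    refine ⟨?_, ?_, ?_⟩
    · intro x y z x' h h'
      obtain ⟨w, -, rfl, rfl⟩ := (hmem _ _ _).1 h
      obtain ⟨w', -, e₁, e₂⟩ := (hmem _ _ _).1 h'
      have : b₂ * (w - w') = 0 := by linear_combination e₂ - e₁
      have hw : w = w' := by simpa [h₂, sub_eq_zero] using this
      subst hw
      exact add_right_cancel e₁
    · intro x y z y' h h'
      obtain ⟨w, -, rfl, rfl⟩ := (hmem _ _ _).1 h
      obtain ⟨w', -, rfl, e₂⟩ := (hmem _ _ _).1 h'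
      have hw : w = w' := mul_left_cancel₀ h₁₂ (add_left_cancel e₂)
      rw [hw]
    · intro x y z z' h h'
      obtain ⟨w, -, rfl, rfl⟩ := (hmem _ _ _).1 h
      obtain ⟨w', -, e₁, rfl⟩ := (hmem _ _ _).1 h'
      have hw : w = w' := mul_left_cancel₀ h₁ (add_left_cancel e₁)
      rw [hw]
  -- There are `3|F|` vertices, so `ε|F|²` disjoint triangles are a proportion `ε/9` of the squared
  -- order; cubing `3|F|` gives the 27 in `threeTermDensity`.
  have hfar : (graph t).FarFromTriangleFree (ε / 9) := by
    apply farFromTriangleFree t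
    rw [htcard]
    push_cast
    have := mul_le_mul_of_nonneg_left hD (Nat.cast_nonneg (α := ℝ) (Fintype.card F))
    linarith
  have hbound := hfar.le_card_cliqueFinset
  -- The three edges of a triangle carry elements `w₁`, `w₂`, `w₃` of `D`; compatibility of the
  -- edges is the equation.
  have hsub : (graph t).cliqueFinset 3 ⊆
      ((Finset.univ : Finset F) ×ˢ threeTermSolutions b₁ b₂ D).image
        fun u => toTriangle (u.1, u.1 + b₁ * u.2.1, u.1 + (b₁ + b₂) * u.2.2.2) := by
    intro s hs
    rw [SimpleGraph.mem_cliqueFinset_iff, SimpleGraph.is3Clique_iff] at hs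
    obtain ⟨x, y, z, hxy, hxz, hyz, rfl⟩ := hs
    obtain ⟨a, b, c, habc, hab, hac, hbc⟩ := graph_triple hxy hxz hyz
    obtain ⟨c', hc'⟩ := Graph.in₀₁_iff.1 hab
    obtain ⟨b', hb'⟩ := Graph.in₀₂_iff.1 hac
    obtain ⟨a', ha'⟩ := Graph.in₁₂_iff.1 hbc
    obtain ⟨w₁, hw₁, rfl, -⟩ := (hmem _ _ _).1 hc'
    obtain ⟨w₃, hw₃, -, rfl⟩ := (hmem _ _ _).1 hb'
    obtain ⟨w₂, hw₂, e₁, e₂⟩ := (hmem _ _ _).1 ha'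
    refine Finset.mem_image.2 ⟨(a, w₁, w₂, w₃), ?_, habc⟩
    simp only [Finset.mem_product, Finset.mem_univ, true_and, threeTermSolutions,
      Finset.mem_filter]
    exact ⟨⟨hw₁, hw₂, hw₃⟩, by linear_combination e₁ - e₂⟩
  have hcard := (Finset.card_le_card hsub).trans Finset.card_image_le
  rw [Finset.card_product, Finset.card_univ] at hcard
  have hF : (0 : ℝ) < Fintype.card F := by exact_mod_cast Fintype.card_pos
  have hcard' : (((graph t).cliqueFinset 3).card : ℝ) ≤
      Fintype.card F * (threeTermSolutions b₁ b₂ D).card := by exact_mod_cast hcard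
  simp only [Fintype.card_sum] at hbound
  push_cast at hbound
  refine le_of_mul_le_mul_left ?_ hF
  refine le_trans (le_of_eq ?_) (hbound.trans hcard')
  rw [threeTermDensity]
  ring

/-- The pairs in `D` whose weighted average with weights `b₁`, `b₂` is `w`. -/
def averagePairs (b₁ b₂ : F) (D : Finset F) (w : F) : Finset (F × F) :=
  (D ×ˢ D).filter fun u => b₁ * u.1 + b₂ * u.2 = (b₁ + b₂) * w

/-- If the unpopular points had density `ε`, supersaturation inside their own set would give some of
them many representations. -/
theorem card_few_averagePairs_lt {b₁ b₂ : F} (h₁ : b₁ ≠ 0) (h₂ : b₂ ≠ 0) (h₁₂ : b₁ + b₂ ≠ 0)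
    (D : Finset F) {ε : ℝ} (hε : 0 < ε) :
    ((D.filter fun w => ((averagePairs b₁ b₂ D w).card : ℝ) <
      threeTermDensity ε * Fintype.card F).card : ℝ) < ε * Fintype.card F := by
  by_contra! hcon
  set E := D.filter fun w => ((averagePairs b₁ b₂ D w).card : ℝ) <
      threeTermDensity ε * Fintype.card F with hE
  have hF : (0 : ℝ) < Fintype.card F := by exact_mod_cast Fintype.card_pos
  have hlow := threeTermDensity_le_card h₁ h₂ h₁₂ hcon
  have hEne : E.Nonempty := by
    rw [← Finset.card_pos]
    exact_mod_cast (mul_pos hε hF).trans_le hcon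
  have hsub : threeTermSolutions b₁ b₂ E ⊆
      (E.sigma fun w => averagePairs b₁ b₂ D w).image fun u => (u.2.1, u.2.2, u.1) := by
    rintro ⟨x, y, z⟩ h
    simp only [threeTermSolutions, Finset.mem_filter, Finset.mem_product] at h
    obtain ⟨⟨hx, hy, hz⟩, h⟩ := h
    refine Finset.mem_image.2 ⟨⟨z, x, y⟩, ?_, rfl⟩
    simp only [Finset.mem_sigma, averagePairs, Finset.mem_filter, Finset.mem_product]
    exact ⟨hz, ⟨(Finset.mem_filter.1 hx).1, (Finset.mem_filter.1 hy).1⟩, h⟩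
  have hcard := (Finset.card_le_card hsub).trans Finset.card_image_le
  rw [Finset.card_sigma] at hcard
  have hcard' : ((threeTermSolutions b₁ b₂ E).card : ℝ) ≤
      ∑ w ∈ E, ((averagePairs b₁ b₂ D w).card : ℝ) := by exact_mod_cast hcard
  have hlt : ∑ w ∈ E, ((averagePairs b₁ b₂ D w).card : ℝ) <
      ∑ w ∈ E, threeTermDensity ε * Fintype.card F :=
    Finset.sum_lt_sum_of_nonempty hEne fun w hw => (Finset.mem_filter.1 hw).2
  rw [Finset.sum_const, nsmul_eq_mul] at hlt
  have hEF : (E.card : ℝ) ≤ Fintype.card F := by exact_mod_cast Finset.card_le_univ E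
  have := mul_le_mul_of_nonneg_right hEF
    (mul_nonneg (threeTermDensity_pos hε).le hF.le)
  nlinarith

/-- The solutions of `∑ i, cᵢxᵢ = 0` with all variables in `S`. -/
def linearSolutions {k : ℕ} (c : Fin k → F) (S : Finset F) : Finset (Fin k → F) :=
  Finset.univ.filter fun x => (∀ i, x i ∈ S) ∧ ∑ i, c i * x i = 0

theorem mem_linearSolutions {k : ℕ} {c : Fin k → F} {S : Finset F} {x : Fin k → F} :
    x ∈ linearSolutions c S ↔ (∀ i, x i ∈ S) ∧ ∑ i, c i * x i = 0 := by
  simp [linearSolutions]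

/-- The density of solutions of a five-term equation guaranteed in sets of density `ε`. -/
noncomputable def fiveTermDensity (ε : ℝ) : ℝ :=
  threeTermDensity (ε / 2) * threeTermDensity (ε / 4) ^ 2

theorem fiveTermDensity_pos {ε : ℝ} (hε : 0 < ε) : 0 < fiveTermDensity ε :=
  mul_pos (threeTermDensity_pos (by positivity))
    (pow_pos (threeTermDensity_pos (by positivity)) 2)

/-- The equation splits into three three-term ones: `u` averages `x₀, x₁`, `v` averages `x₂, x₃`,
and `x₄` averages `u, v`. Discarding unpopular points keeps half the density; each solution `(u, v,
x₄)` among the rest then lifts in many ways. -/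
theorem fiveTermDensity_le_card {c : Fin 5 → F} (hc : ∀ i, c i ≠ 0) (hsum : ∑ i, c i = 0)
    (h₀₁ : c 0 + c 1 ≠ 0) (h₂₃ : c 2 + c 3 ≠ 0) {D : Finset F} {ε : ℝ} (hε : 0 < ε)
    (hD : ε * Fintype.card F ≤ D.card) :
    fiveTermDensity ε * (Fintype.card F : ℝ) ^ 4 ≤ (linearSolutions c D).card := by
  have hF : (0 : ℝ) < Fintype.card F := by exact_mod_cast Fintype.card_pos
  have hε4 : 0 < ε / 4 := by positivity
  have hbad₁ := card_few_averagePairs_lt (hc 0) (hc 1) h₀₁ D hε4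
  have hbad₂ := card_few_averagePairs_lt (hc 2) (hc 3) h₂₃ D hε4
  set κ := threeTermDensity (ε / 4) with hκ
  have hκpos : 0 < κ := threeTermDensity_pos hε4
  set E₁ := D.filter fun w => ((averagePairs (c 0) (c 1) D w).card : ℝ) < κ * Fintype.card F
  set E₂ := D.filter fun w => ((averagePairs (c 2) (c 3) D w).card : ℝ) < κ * Fintype.card F
  set G := D \ (E₁ ∪ E₂) with hG
  have hGcard : ε / 2 * Fintype.card F ≤ G.card := by
    have h1 : D.card ≤ G.card + (E₁.card + E₂.card) := by
      have : D.card - (E₁ ∪ E₂).card ≤ (D \ (E₁ ∪ E₂)).card := Finset.le_card_sdiff _ _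
      have := Finset.card_union_le E₁ E₂
      rw [hG]
      omega
    have h1' : (D.card : ℝ) ≤ G.card + (E₁.card + E₂.card) := by exact_mod_cast h1
    linarith
  have hG₁ : ∀ w ∈ G, κ * Fintype.card F ≤ (averagePairs (c 0) (c 1) D w).card := by
    intro w hw
    simp only [hG, Finset.mem_sdiff, Finset.mem_union, not_or] at hw
    by_contra! h
    exact hw.2.1 (Finset.mem_filter.2 ⟨hw.1, h⟩)
  have hG₂ : ∀ w ∈ G, κ * Fintype.card F ≤ (averagePairs (c 2) (c 3) D w).card := by
    intro w hw
    simp only [hG, Finset.mem_sdiff, Finset.mem_union, not_or] at hw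
    by_contra! h
    exact hw.2.2 (Finset.mem_filter.2 ⟨hw.1, h⟩)
  have hsum' : c 0 + c 1 + (c 2 + c 3) = -c 4 := by
    rw [Fin.sum_univ_five] at hsum
    linear_combination hsum
  have hlow := threeTermDensity_le_card h₀₁ h₂₃
    (by rw [hsum']; exact neg_ne_zero.2 (hc 4)) hGcard
  have hinj : ((threeTermSolutions (c 0 + c 1) (c 2 + c 3) G).sigma fun w =>
      averagePairs (c 0) (c 1) D w.1 ×ˢ averagePairs (c 2) (c 3) D w.2.1).card ≤
        (linearSolutions c D).card := by
    -- Forgetting `u` and `v` loses nothing: the pairs determine them, as the coefficient sums are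
    -- nonzero.
    refine Finset.card_le_card_of_injOn
      (fun u => ![u.2.1.1, u.2.1.2, u.2.2.1, u.2.2.2, u.1.2.2]) ?_ ?_
    · rintro ⟨⟨u, v, w⟩, ⟨x₀, x₁⟩, x₂, x₃⟩ h
      simp only [Finset.coe_sigma, Set.mem_sigma_iff, Finset.mem_coe, threeTermSolutions,
        averagePairs, Finset.mem_filter, Finset.mem_product] at h
      obtain ⟨⟨⟨hu, hv, hw⟩, e⟩, ⟨⟨hx₀, hx₁⟩, e₁⟩, ⟨hx₂, hx₃⟩, e₂⟩ := h
      have hwD : w ∈ D := (Finset.mem_sdiff.1 hw).1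
      rw [Finset.mem_coe, mem_linearSolutions]
      refine ⟨?_, ?_⟩
      · intro i
        fin_cases i <;> assumption
      · simp only [Fin.sum_univ_five, Matrix.cons_val]
        rw [hsum'] at e
        linear_combination e + e₁ + e₂
    · rintro ⟨⟨u, v, w⟩, ⟨x₀, x₁⟩, x₂, x₃⟩ h ⟨⟨u', v', w'⟩, ⟨x₀', x₁'⟩, x₂', x₃'⟩ h' heq
      simp only [Finset.coe_sigma, Set.mem_sigma_iff, Finset.mem_coe, threeTermSolutions,
        averagePairs, Finset.mem_filter, Finset.mem_product] at h h'
      obtain ⟨-, ⟨-, e₁⟩, -, e₂⟩ := h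
      obtain ⟨-, ⟨-, e₁'⟩, -, e₂'⟩ := h'
      have g := fun i => congrFun heq i
      have g0 : x₀ = x₀' := g 0
      have g1 : x₁ = x₁' := g 1
      have g2 : x₂ = x₂' := g 2
      have g3 : x₃ = x₃' := g 3
      have g4 : w = w' := g 4
      subst g0 g1 g2 g3 g4
      have hu : u = u' := mul_left_cancel₀ h₀₁ (e₁.symm.trans e₁')
      have hv : v = v' := mul_left_cancel₀ h₂₃ (e₂.symm.trans e₂')
      rw [hu, hv]
  rw [Finset.card_sigma] at hinj
  have hinj' : ∑ w ∈ threeTermSolutions (c 0 + c 1) (c 2 + c 3) G,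
      ((averagePairs (c 0) (c 1) D w.1).card : ℝ) * (averagePairs (c 2) (c 3) D w.2.1).card ≤
        (linearSolutions c D).card := by
    simp only [Finset.card_product] at hinj
    exact_mod_cast hinj
  have hterm : ∑ w ∈ threeTermSolutions (c 0 + c 1) (c 2 + c 3) G,
      (κ * Fintype.card F) * (κ * Fintype.card F) ≤
      ∑ w ∈ threeTermSolutions (c 0 + c 1) (c 2 + c 3) G,
      ((averagePairs (c 0) (c 1) D w.1).card : ℝ) * (averagePairs (c 2) (c 3) D w.2.1).card := by
    refine Finset.sum_le_sum fun w hw => ?_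
    simp only [threeTermSolutions, Finset.mem_filter, Finset.mem_product] at hw
    exact mul_le_mul (hG₁ _ hw.1.1) (hG₂ _ hw.1.2.1) (by positivity) (by positivity)
  rw [Finset.sum_const, nsmul_eq_mul] at hterm
  refine le_trans ?_ (hterm.trans hinj')
  refine le_trans (le_of_eq ?_) (mul_le_mul_of_nonneg_right hlow (by positivity))
  rw [fiveTermDensity]
  ring

end Supersaturation

/-! ### Bohr sets by pigeonhole -/

section Bohr

/-- The unit circle is covered by finitely many discs, so by pigeonhole the characters
`ψ(r ·)`, `r ∈ R`, are simultaneously close to `1` on a set of bounded codensity. -/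
theorem exists_bohr_bound {η : ℝ} (hη : 0 < η) :
    ∃ K : ℕ, 0 < K ∧ ∀ (F : Type) [Field F] [Fintype F] [DecidableEq F] (ψ : AddChar F ℂ)
      (R : Finset F), ∃ B : Finset F, B.Nonempty ∧ Fintype.card F ≤ K ^ R.card * B.card ∧
        ∀ x ∈ B, ∀ r ∈ R, ‖ψ (r * x) - 1‖ ≤ η := by
  classical
  obtain ⟨t₀, ht₀fin, ht₀⟩ := Metric.totallyBounded_iff.1
    (isCompact_sphere (0 : ℂ) 1).totallyBounded (η / 2) (half_pos hη)
  obtain ⟨t, rfl⟩ := ht₀fin.exists_finset_coe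
  have hcover : ∀ z : ℂ, ‖z‖ = 1 → ∃ y ∈ t, dist z y < η / 2 := by
    intro z hz
    simpa using ht₀ (mem_sphere_zero_iff_norm.2 hz)
  have htpos : 0 < t.card := by
    obtain ⟨y, hy, -⟩ := hcover 1 (by simp)
    exact Finset.card_pos.2 ⟨y, hy⟩
  refine ⟨t.card, htpos, fun F _ _ _ ψ R => ?_⟩
  choose y hyt hy using fun x : F => hcover (ψ x) (AddChar.norm_apply ψ x)
  set f : F → (R → t) := fun x r => ⟨y (r * x), hyt _⟩ with hf
  have : Nonempty (R → t) := ⟨f 0⟩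
  have htR : (0 : ℝ) < (t.card : ℝ) ^ R.card := by positivity
  obtain ⟨v, hv⟩ := Fintype.exists_le_card_fiber_of_nsmul_le_card f
    (b := (Fintype.card F : ℝ) / (t.card : ℝ) ^ R.card) (by
      rw [nsmul_eq_mul, Fintype.card_fun, Fintype.card_coe, Fintype.card_coe]
      push_cast
      rw [mul_div_cancel₀ _ htR.ne'])
  set E := Finset.univ.filter fun x => f x = v with hE
  have hE0 : 0 < E.card := by
    have h : (0 : ℝ) < E.card := lt_of_lt_of_le (div_pos (by exact_mod_cast Fintype.card_pos) htR) hv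
    exact_mod_cast h
  obtain ⟨x₀, hx₀⟩ := Finset.card_pos.1 hE0
  -- Translating by a point of the fibre turns mutual closeness of character values into closeness
  -- to 1.
  refine ⟨E.image fun x => x - x₀, ⟨_, Finset.mem_image_of_mem _ hx₀⟩, ?_, ?_⟩
  · rw [Finset.card_image_of_injective _ sub_left_injective]
    rw [div_le_iff₀ htR, mul_comm] at hv
    exact_mod_cast hv
  · intro x hx r hr
    obtain ⟨x', hx', rfl⟩ := Finset.mem_image.1 hx
    have heq : y (r * x') = y (r * x₀) := by
      have h := (Finset.mem_filter.1 hx').2.trans (Finset.mem_filter.1 hx₀).2.symm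
      exact congrArg Subtype.val (congrFun h ⟨r, hr⟩)
    have hfac : ψ (r * (x' - x₀)) - 1 = (ψ (r * x') - ψ (r * x₀)) * ψ (-(r * x₀)) := by
      rw [sub_mul, ← AddChar.map_add_eq_mul, ← AddChar.map_add_eq_mul, add_neg_cancel,
        AddChar.map_zero_eq_one, mul_sub, sub_eq_add_neg (r * x')]
    rw [hfac, norm_mul, AddChar.norm_apply, mul_one, ← dist_eq_norm]
    have h₁ := hy (r * x')
    have h₂ := hy (r * x₀)
    rw [heq] at h₁
    have := dist_triangle_right (ψ (r * x')) (ψ (r * x₀)) (y (r * x₀))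
    linarith

end Bohr

/-! ### Fourier counting and the fourth moment of a Sidon set -/

section Fourier

variable {F : Type} [Field F] [Fintype F] [DecidableEq F] {ψ : AddChar F ℂ}

/-- The Fourier transform on a finite field with respect to the additive character `ψ`. -/
noncomputable def fourierSum (ψ : AddChar F ℂ) (f : F → ℝ) (r : F) : ℂ :=
  ∑ x, (f x : ℂ) * ψ (r * x)

theorem addChar_sum (ψ : AddChar F ℂ) {ι : Type*} (s : Finset ι) (x : ι → F) :
    ψ (∑ i ∈ s, x i) = ∏ i ∈ s, ψ (x i) := by
  classical
  induction s using Finset.induction_on with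
  | empty => simp
  | insert i s hi ih =>
    rw [Finset.sum_insert hi, Finset.prod_insert hi, AddChar.map_add_eq_mul, ih]

/-- Expand the product; orthogonality of characters keeps only the tuples on the hyperplane. -/
theorem sum_prod_fourierSum (hψ : ψ.IsPrimitive) {k : ℕ} (c : Fin k → F) (f : F → ℝ) :
    ∑ r, ∏ i, fourierSum ψ f (c i * r) =
      Fintype.card F * ((∑ x : Fin k → F with ∑ i, c i * x i = 0, ∏ i, f (x i) : ℝ) : ℂ) := by
  have hexp : ∀ r, ∏ i, fourierSum ψ f (c i * r) =
      ∑ x : Fin k → F, (∏ i, (f (x i) : ℂ)) * ψ (r * ∑ i, c i * x i) := by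
    intro r
    simp only [fourierSum]
    rw [Finset.prod_univ_sum, Fintype.piFinset_univ]
    refine Finset.sum_congr rfl fun x _ => ?_
    rw [Finset.prod_mul_distrib, Finset.mul_sum, addChar_sum]
    congr 1
    refine Finset.prod_congr rfl fun i _ => ?_
    congr 1
    ring
  simp only [hexp]
  rw [Finset.sum_comm]
  simp only [← Finset.mul_sum, AddChar.sum_mulShift _ hψ]
  rw [Finset.sum_filter]
  push_cast
  rw [Finset.mul_sum]
  refine Finset.sum_congr rfl fun x _ => ?_
  split_ifs <;> simp [mul_comm]

/-- The indicator function of a finite set. -/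
def indicatorFn (S : Finset F) (x : F) : ℝ := if x ∈ S then 1 else 0

theorem prod_indicatorFn {k : ℕ} (S : Finset F) (x : Fin k → F) :
    ∏ i, indicatorFn S (x i) = if ∀ i, x i ∈ S then 1 else 0 := by
  simp only [indicatorFn]
  split_ifs with h
  · exact Finset.prod_eq_one fun i _ => if_pos (h i)
  · push Not at h
    obtain ⟨i, hi⟩ := h
    exact Finset.prod_eq_zero (Finset.mem_univ i) (if_neg hi)

theorem sum_prod_indicatorFn {k : ℕ} (c : Fin k → F) (S : Finset F) :
    ∑ x : Fin k → F with ∑ i, c i * x i = 0, ∏ i, indicatorFn S (x i) =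
      (linearSolutions c S).card := by
  simp only [prod_indicatorFn, ← Finset.sum_filter, Finset.sum_const, nsmul_eq_mul, mul_one,
    linearSolutions, Finset.filter_filter]
  simp only [and_comm]

theorem norm_fourierSum_indicatorFn_le (S : Finset F) (r : F) :
    ‖fourierSum ψ (indicatorFn S) r‖ ≤ S.card := by
  refine (norm_sum_le _ _).trans (le_of_eq ?_)
  simp [indicatorFn, apply_ite]

theorem fourierSum_neg (f : F → ℝ) (r : F) :
    fourierSum ψ f (-r) = starRingEnd ℂ (fourierSum ψ f r) := by
  simp only [fourierSum, map_sum, map_mul, Complex.conj_ofReal]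
  refine Finset.sum_congr rfl fun x _ => ?_
  rw [neg_mul, AddChar.map_neg_eq_conj]

/-- Sidon sets in an additive group. -/
def IsSidonIn (S : Finset F) : Prop :=
  ∀ x₁ ∈ S, ∀ x₂ ∈ S, ∀ x₃ ∈ S, ∀ x₄ ∈ S, x₁ + x₂ = x₃ + x₄ →
    (x₁ = x₃ ∧ x₂ = x₄) ∨ (x₁ = x₄ ∧ x₂ = x₃)

theorem IsSidonIn.sq_card_le {S : Finset F} (hS : IsSidonIn S) :
    S.card ^ 2 ≤ 2 * Fintype.card F := by
  have h := Finset.card_le_mul_card_image_of_maps_to (s := S ×ˢ S) (t := Finset.univ)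
    (f := fun u : F × F => u.1 + u.2) (fun _ _ => Finset.mem_univ _) 2 ?_
  · rwa [Finset.card_product, ← sq, Finset.card_univ] at h
  · intro s _
    rcases Finset.eq_empty_or_nonempty ((S ×ˢ S).filter fun u : F × F => u.1 + u.2 = s) with h | h
    · simp [h]
    · obtain ⟨⟨x, y⟩, hxy⟩ := h
      simp only [Finset.mem_filter, Finset.mem_product] at hxy
      refine (Finset.card_le_card (t := {(x, y), (y, x)}) ?_).trans Finset.card_le_two
      rintro ⟨x', y'⟩ h'
      simp only [Finset.mem_filter, Finset.mem_product] at h'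
      have := hS x' h'.1.1 y' h'.1.2 x hxy.1.1 y hxy.1.2 (h'.2.trans hxy.2.symm)
      simpa using this

theorem IsSidonIn.card_additive_quadruples_le {S : Finset F} (hS : IsSidonIn S) :
    (linearSolutions ![1, 1, -1, -1] S).card ≤ 2 * S.card ^ 2 := by
  have hsub : linearSolutions ![1, 1, -1, -1] S ⊆
      (S ×ˢ S).image (fun u => ![u.1, u.2, u.1, u.2]) ∪
        (S ×ˢ S).image (fun u => ![u.1, u.2, u.2, u.1]) := by
    intro x hx
    rw [mem_linearSolutions] at hx
    obtain ⟨hx, h⟩ := hx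
    simp only [Fin.sum_univ_four, Matrix.cons_val] at h
    rw [Finset.mem_union, Finset.mem_image, Finset.mem_image]
    rcases hS _ (hx 0) _ (hx 1) _ (hx 2) _ (hx 3) (by linear_combination h) with ⟨h₁, h₂⟩ | ⟨h₁, h₂⟩
    · refine Or.inl ⟨(x 0, x 1), Finset.mem_product.2 ⟨hx 0, hx 1⟩, ?_⟩
      funext i
      fin_cases i <;> simp [h₁, h₂]
    · refine Or.inr ⟨(x 0, x 1), Finset.mem_product.2 ⟨hx 0, hx 1⟩, ?_⟩
      funext i
      fin_cases i <;> simp [h₁, h₂]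
  refine (Finset.card_le_card hsub).trans ((Finset.card_union_le _ _).trans ?_)
  have h₁ := Finset.card_image_le (s := S ×ˢ S) (f := fun u => ![u.1, u.2, u.1, u.2])
  have h₂ := Finset.card_image_le (s := S ×ˢ S) (f := fun u => ![u.1, u.2, u.2, u.1])
  rw [Finset.card_product] at h₁ h₂
  nlinarith

/-- The fourth moment counts solutions of `x₁ + x₂ = x₃ + x₄`, all trivial in a Sidon set. -/
theorem IsSidonIn.sum_norm_fourierSum_pow_four_le (hψ : ψ.IsPrimitive) {S : Finset F}
    (hS : IsSidonIn S) :
    ∑ r, ‖fourierSum ψ (indicatorFn S) r‖ ^ 4 ≤ Fintype.card F * (2 * (S.card : ℝ) ^ 2) := by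
  have h := sum_prod_fourierSum hψ ![1, 1, -1, -1] (indicatorFn S)
  rw [sum_prod_indicatorFn] at h
  have hterm : ∀ r, ∏ i, fourierSum ψ (indicatorFn S) ((![1, 1, -1, -1] : Fin 4 → F) i * r) =
      ((‖fourierSum ψ (indicatorFn S) r‖ ^ 4 : ℝ) : ℂ) := by
    intro r
    simp only [Fin.prod_univ_four, Matrix.cons_val, one_mul, neg_mul, fourierSum_neg]
    have := Complex.mul_conj' (fourierSum ψ (indicatorFn S) r)
    push_cast
    linear_combination (fourierSum ψ (indicatorFn S) r *
      starRingEnd ℂ (fourierSum ψ (indicatorFn S) r) +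
        (‖fourierSum ψ (indicatorFn S) r‖ : ℂ) ^ 2) * this
  simp only [hterm] at h
  have h' : ∑ r, ‖fourierSum ψ (indicatorFn S) r‖ ^ 4 =
      Fintype.card F * ((linearSolutions ![1, 1, -1, -1] S).card : ℝ) := by exact_mod_cast h
  rw [h']
  exact mul_le_mul_of_nonneg_left (by exact_mod_cast hS.card_additive_quadruples_le)
    (Nat.cast_nonneg _)

/-- AM–GM separates the factors, and a nonzero dilation only permutes the frequencies. -/
theorem sum_prod_four_le (c : Fin 4 → F) (hc : ∀ i, c i ≠ 0) (φ : F → ℝ) :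
    ∑ r, ∏ i, |φ (c i * r)| ≤ ∑ r, |φ r| ^ 4 := by
  have hdil : ∀ i, ∑ r, |φ (c i * r)| ^ 4 = ∑ r, |φ r| ^ 4 := fun i =>
    Equiv.sum_comp (Equiv.mulLeft₀ (c i) (hc i)) fun r => |φ r| ^ 4
  have hamgm : ∀ r, ∏ i, |φ (c i * r)| ≤ (∑ i, |φ (c i * r)| ^ 4) / 4 := by
    intro r
    simp only [Fin.prod_univ_four, Fin.sum_univ_four]
    set w := |φ (c 0 * r)|
    set x := |φ (c 1 * r)|
    set y := |φ (c 2 * r)|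
    set z := |φ (c 3 * r)|
    nlinarith [sq_nonneg (w * x - y * z), sq_nonneg (w ^ 2 - x ^ 2), sq_nonneg (y ^ 2 - z ^ 2)]
  refine (Finset.sum_le_sum fun r _ => hamgm r).trans (le_of_eq ?_)
  rw [← Finset.sum_div, Finset.sum_comm]
  simp only [hdil]
  simp

theorem IsSidonIn.card_linearSolutions_four_le (hψ : ψ.IsPrimitive) {S : Finset F}
    (hS : IsSidonIn S) {c : Fin 4 → F} (hc : ∀ i, c i ≠ 0) :
    (linearSolutions c S).card ≤ 2 * S.card ^ 2 := by
  have h := sum_prod_fourierSum hψ c (indicatorFn S)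
  rw [sum_prod_indicatorFn] at h
  have hF : (0 : ℝ) < Fintype.card F := by exact_mod_cast Fintype.card_pos
  have h1 : (Fintype.card F : ℝ) * (linearSolutions c S).card ≤
      Fintype.card F * (2 * (S.card : ℝ) ^ 2) := by
    calc (Fintype.card F : ℝ) * (linearSolutions c S).card
        = ‖∑ r, ∏ i, fourierSum ψ (indicatorFn S) (c i * r)‖ := by
          rw [h]; simp
      _ ≤ ∑ r, ∏ i, |‖fourierSum ψ (indicatorFn S) (c i * r)‖| := by
          refine (norm_sum_le _ _).trans (le_of_eq ?_)
          simp only [norm_prod, abs_norm]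
      _ ≤ ∑ r, |‖fourierSum ψ (indicatorFn S) r‖| ^ 4 :=
          sum_prod_four_le c hc fun r => ‖fourierSum ψ (indicatorFn S) r‖
      _ ≤ _ := by
          simp only [abs_norm]
          exact hS.sum_norm_fourierSum_pow_four_le hψ
  exact_mod_cast le_of_mul_le_mul_left h1 hF

theorem norm_one_sub_prod_le {ι : Type*} (s : Finset ι) (m : ι → ℂ) (hm : ∀ i, ‖m i‖ ≤ 1) :
    ‖1 - ∏ i ∈ s, m i‖ ≤ ∑ i ∈ s, ‖1 - m i‖ := by
  classical
  induction s using Finset.induction_on with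
  | empty => simp
  | insert i s hi ih =>
    rw [Finset.prod_insert hi, Finset.sum_insert hi]
    calc ‖1 - m i * ∏ j ∈ s, m j‖ = ‖(1 - m i) + m i * (1 - ∏ j ∈ s, m j)‖ := by congr 1; ring
      _ ≤ ‖1 - m i‖ + ‖m i‖ * ‖1 - ∏ j ∈ s, m j‖ := by
          rw [← norm_mul]; exact norm_add_le _ _
      _ ≤ ‖1 - m i‖ + ∑ j ∈ s, ‖1 - m j‖ := by
          have := mul_le_mul_of_nonneg_right (hm i) (norm_nonneg (1 - ∏ j ∈ s, m j))
          linarith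

/-- Replacing `f` by `g` with `ĝ = f̂ m` changes a five-term count by little, if `f̂ (1 - m)` is
uniformly small. -/
theorem abs_sum_prod_sub_sum_prod_le (hψ : ψ.IsPrimitive) {c : Fin 5 → F} (hc : ∀ i, c i ≠ 0)
    {f g : F → ℝ} {m : F → ℂ} (hg : ∀ r, fourierSum ψ g r = fourierSum ψ f r * m r)
    (hm : ∀ r, ‖m r‖ ≤ 1) {κ : ℝ} (hκ : ∀ r, ‖fourierSum ψ f r‖ * ‖1 - m r‖ ≤ κ) :
    Fintype.card F * |∑ x : Fin 5 → F with ∑ i, c i * x i = 0, ∏ i, f (x i) -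
      ∑ x : Fin 5 → F with ∑ i, c i * x i = 0, ∏ i, g (x i)| ≤
        5 * κ * ∑ r, ‖fourierSum ψ f r‖ ^ 4 := by
  have hf' := sum_prod_fourierSum hψ c f
  have hg' := sum_prod_fourierSum hψ c g
  have hnorm : (Fintype.card F : ℝ) * |∑ x : Fin 5 → F with ∑ i, c i * x i = 0, ∏ i, f (x i) -
      ∑ x : Fin 5 → F with ∑ i, c i * x i = 0, ∏ i, g (x i)| =
      ‖∑ r, (∏ i, fourierSum ψ f (c i * r)) * (1 - ∏ i, m (c i * r))‖ := by
    have : ∑ r, (∏ i, fourierSum ψ f (c i * r)) * (1 - ∏ i, m (c i * r)) =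
        ((Fintype.card F * (∑ x : Fin 5 → F with ∑ i, c i * x i = 0, ∏ i, f (x i) -
          ∑ x : Fin 5 → F with ∑ i, c i * x i = 0, ∏ i, g (x i)) : ℝ) : ℂ) := by
      rw [Complex.ofReal_mul, Complex.ofReal_sub, mul_sub, Complex.ofReal_natCast, ← hf', ← hg',
        ← Finset.sum_sub_distrib]
      refine Finset.sum_congr rfl fun r _ => ?_
      simp only [hg, Finset.prod_mul_distrib]
      ring
    rw [this, Complex.norm_real, Real.norm_eq_abs, abs_mul, Nat.abs_cast]
  rw [hnorm]
  have hκ0 : 0 ≤ κ := (mul_nonneg (norm_nonneg _) (norm_nonneg _)).trans (hκ 0)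
  -- Telescoping `1 - ∏ m` pairs one transform with its own `1 - m`, bounded by `κ`, and leaves the
  -- other four.
  have hterm : ∀ r, ‖(∏ i, fourierSum ψ f (c i * r)) * (1 - ∏ i, m (c i * r))‖ ≤
      ∑ i : Fin 5, κ * ∏ j : Fin 4, |‖fourierSum ψ f (c (i.succAbove j) * r)‖| := by
    intro r
    rw [norm_mul, norm_prod]
    refine (mul_le_mul_of_nonneg_left (norm_one_sub_prod_le _ (fun i => m (c i * r))
      fun i => hm _) (Finset.prod_nonneg fun i _ => norm_nonneg _)).trans ?_
    rw [Finset.mul_sum]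
    refine Finset.sum_le_sum fun i _ => ?_
    rw [Fin.prod_univ_succAbove _ i, mul_right_comm]
    simp only [abs_norm]
    exact mul_le_mul_of_nonneg_right (hκ _) (Finset.prod_nonneg fun i _ => norm_nonneg _)
  refine (norm_sum_le _ _).trans ((Finset.sum_le_sum fun r _ => hterm r).trans ?_)
  rw [Finset.sum_comm]
  have hi : ∀ i : Fin 5, ∑ r, κ * ∏ j : Fin 4, |‖fourierSum ψ f (c (i.succAbove j) * r)‖| ≤
      κ * ∑ r, ‖fourierSum ψ f r‖ ^ 4 := by
    intro i
    rw [← Finset.mul_sum]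
    refine mul_le_mul_of_nonneg_left ?_ hκ0
    have := sum_prod_four_le (fun j => c (i.succAbove j)) (fun j => hc _)
      fun r => ‖fourierSum ψ f r‖
    simpa only [abs_norm] using this
  refine (Finset.sum_le_sum fun i _ => hi i).trans (le_of_eq ?_)
  simp
  ring

end Fourier

/-! ### Averaging a Sidon set over translates -/

section Smoothing

variable {F : Type} [Field F] [Fintype F] [DecidableEq F] {ψ : AddChar F ℂ}

/-- The average of the indicator function of `S` over translates by `B`. -/
noncomputable def smoothed (S B : Finset F) (x : F) : ℝ :=
  (∑ b ∈ B, indicatorFn S (x - b)) / B.card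

/-- The average of the character `ψ(r ·)` over `B`. -/
noncomputable def charAverage (ψ : AddChar F ℂ) (B : Finset F) (r : F) : ℂ :=
  (∑ b ∈ B, ψ (r * b)) / B.card

theorem smoothed_nonneg (S B : Finset F) (x : F) : 0 ≤ smoothed S B x := by
  refine div_nonneg (Finset.sum_nonneg fun b _ => ?_) (Nat.cast_nonneg _)
  rw [indicatorFn]
  split_ifs <;> norm_num

theorem sum_indicatorFn (S : Finset F) : ∑ x, indicatorFn S x = S.card := by
  simp [indicatorFn]

theorem sum_indicatorFn_sub (S : Finset F) (b : F) : ∑ x, indicatorFn S (x - b) = S.card := by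
  rw [← sum_indicatorFn]
  exact Equiv.sum_comp (Equiv.subRight b) (indicatorFn S)

theorem sum_smoothed (S : Finset F) {B : Finset F} (hB : B.Nonempty) :
    ∑ x, smoothed S B x = S.card := by
  simp only [smoothed]
  rw [← Finset.sum_div, Finset.sum_comm]
  simp only [sum_indicatorFn_sub, Finset.sum_const, nsmul_eq_mul]
  have : (B.card : ℝ) ≠ 0 := by exact_mod_cast hB.card_pos.ne'
  field_simp

theorem fourierSum_smoothed (S B : Finset F) (r : F) :
    fourierSum ψ (smoothed S B) r = fourierSum ψ (indicatorFn S) r * charAverage ψ B r := by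
  simp only [fourierSum, smoothed, charAverage]
  rw [mul_div_assoc', Finset.mul_sum]
  push_cast
  simp only [div_mul_eq_mul_div, Finset.sum_mul]
  rw [← Finset.sum_div, Finset.sum_comm]
  congr 1
  refine Finset.sum_congr rfl fun b _ => ?_
  rw [← Equiv.sum_comp (Equiv.addRight b)]
  refine Finset.sum_congr rfl fun x _ => ?_
  simp only [Equiv.coe_addRight, add_sub_cancel_right, mul_add, AddChar.map_add_eq_mul]
  ring

theorem norm_charAverage_le (B : Finset F) (r : F) : ‖charAverage ψ B r‖ ≤ 1 := by
  rw [charAverage, norm_div, Complex.norm_natCast]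
  refine div_le_one_of_le₀ ((norm_sum_le _ _).trans ?_) (Nat.cast_nonneg _)
  simp

theorem norm_one_sub_charAverage_le {B : Finset F} (hB : B.Nonempty) {r : F} {η : ℝ}
    (h : ∀ x ∈ B, ‖ψ (r * x) - 1‖ ≤ η) : ‖1 - charAverage ψ B r‖ ≤ η := by
  have hB0 : (0 : ℝ) < B.card := by exact_mod_cast hB.card_pos
  have hB0' : (B.card : ℂ) ≠ 0 := by exact_mod_cast hB.card_pos.ne'
  have : 1 - charAverage ψ B r = -(∑ b ∈ B, (ψ (r * b) - 1)) / B.card := by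
    rw [charAverage, Finset.sum_sub_distrib]
    simp
    field_simp
  rw [this, norm_div, norm_neg, Complex.norm_natCast, div_le_iff₀ hB0]
  refine (norm_sum_le _ _).trans ((Finset.sum_le_card_nsmul _ _ _ h).trans (le_of_eq ?_))
  rw [nsmul_eq_mul, mul_comm]

/-- Expanding the square, the off-diagonal pairs contribute at most 1 each, since two distinct
translates of a Sidon set share at most one point; the diagonal gives `|S|/|B|`. -/
theorem IsSidonIn.sum_smoothed_sq_le {S B : Finset F} (hS : IsSidonIn S) (hB : B.Nonempty) :
    ∑ x, smoothed S B x ^ 2 ≤ 1 + (S.card : ℝ) / B.card := by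
  have hB0 : (0 : ℝ) < B.card := by exact_mod_cast hB.card_pos
  have hpair : ∀ b b', ∑ x, indicatorFn S (x - b) * indicatorFn S (x - b') ≤
      1 + if b = b' then (S.card : ℝ) else 0 := by
    intro b b'
    have hmul : ∀ x, indicatorFn S (x - b) * indicatorFn S (x - b') =
        if x - b ∈ S ∧ x - b' ∈ S then 1 else 0 := by
      intro x
      simp only [indicatorFn, ite_and]
      split_ifs <;> norm_num
    simp only [hmul]
    split_ifs with hbb
    · subst hbb
      simp only [and_self]
      have := sum_indicatorFn_sub S b
      simp only [indicatorFn] at this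
      rw [this]
      linarith
    · rw [← Finset.sum_filter, Finset.sum_const, nsmul_eq_mul, mul_one, add_zero]
      have : (Finset.univ.filter fun x => x - b ∈ S ∧ x - b' ∈ S).card ≤ 1 := by
        rw [Finset.card_le_one]
        intro x hx y hy
        simp only [Finset.mem_filter, Finset.mem_univ, true_and] at hx hy
        rcases hS _ hx.1 _ hy.2 _ hx.2 _ hy.1 (by ring) with h | h
        · exact absurd (sub_right_injective h.1) hbb
        · exact sub_left_injective h.1
      exact_mod_cast this
  have hexp : ∀ x, smoothed S B x ^ 2 =
      (∑ b ∈ B, ∑ b' ∈ B, indicatorFn S (x - b) * indicatorFn S (x - b')) / (B.card : ℝ) ^ 2 := by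
    intro x
    rw [smoothed, div_pow, sq (∑ b ∈ B, _), Finset.sum_mul_sum]
  simp only [hexp]
  rw [← Finset.sum_div, div_le_iff₀ (by positivity), Finset.sum_comm]
  calc ∑ b ∈ B, ∑ x, ∑ b' ∈ B, indicatorFn S (x - b) * indicatorFn S (x - b')
      = ∑ b ∈ B, ∑ b' ∈ B, ∑ x, indicatorFn S (x - b) * indicatorFn S (x - b') :=
        Finset.sum_congr rfl fun b _ => Finset.sum_comm
    _ ≤ ∑ b ∈ B, ∑ b' ∈ B, (1 + if b = b' then (S.card : ℝ) else 0) :=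
        Finset.sum_le_sum fun b _ => Finset.sum_le_sum fun b' _ => hpair b b'
    _ = (B.card : ℝ) ^ 2 + B.card * S.card := by
        simp only [Finset.sum_add_distrib, Finset.sum_ite_eq, Finset.sum_const, nsmul_eq_mul]
        rw [Finset.sum_ite_mem]
        simp
        ring
    _ = _ := by field_simp

end Smoothing

/-! ### Transference to Sidon sets and degenerate solutions -/

section Transference

/-- A Sidon set of size `δ√|F|` contains a positive proportion of the expected number of solutions
of a translation-invariant equation in five variables. -/
theorem IsSidonIn.exists_le_card_linearSolutions {δ : ℝ} (hδ : 0 < δ) :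
    ∃ γ : ℝ, 0 < γ ∧ ∃ q₀ : ℝ, ∀ (F : Type) [Field F] [Fintype F] [DecidableEq F]
      (ψ : AddChar F ℂ), ψ.IsPrimitive → ∀ c : Fin 5 → F, (∀ i, c i ≠ 0) → ∑ i, c i = 0 →
      c 0 + c 1 ≠ 0 → c 2 + c 3 ≠ 0 → ∀ S : Finset F, IsSidonIn S →
      q₀ ≤ √(Fintype.card F) → δ * √(Fintype.card F) ≤ S.card →
      γ * √(Fintype.card F) ^ 3 ≤ (linearSolutions c S).card := by
  set κ := fiveTermDensity (δ ^ 2 / 4) with hκ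
  have hκ0 : 0 < κ := fiveTermDensity_pos (by positivity)
  set γ := (δ / 4) ^ 5 * κ with hγ
  have hγ0 : 0 < γ := by positivity
  -- The smoothing error `20ηq³` is then half of the main term `γq³`.
  set η := γ / 40 with hη
  have hη0 : 0 < η := by positivity
  obtain ⟨K, hK, hbohr⟩ := exists_bohr_bound (half_pos hη0)
  set W := K ^ ⌈64 / η ^ 4⌉₊ with hW
  have hW0 : 0 < W := pow_pos hK _
  -- The threshold `q ≥ 2W` forces `|B| ≥ q²/W ≥ 2q ≥ |S|`, so the smoothed square sum is at most 2.
  refine ⟨γ / 2, by positivity, 2 * W, ?_⟩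
  intro F _ _ _ ψ hψ c hc hsum h₀₁ h₂₃ S hS hq₀ hSδ
  set q := √(Fintype.card F) with hq
  have hqsq : q ^ 2 = Fintype.card F := Real.sq_sqrt (Nat.cast_nonneg _)
  have hq0 : 0 < q := Real.sqrt_pos.2 (by exact_mod_cast Fintype.card_pos)
  have hW0R : (0 : ℝ) < W := by exact_mod_cast hW0
  have hSsq : (S.card : ℝ) ^ 2 ≤ 2 * q ^ 2 := by rw [hqsq]; exact_mod_cast hS.sq_card_le
  have hSq : (S.card : ℝ) ≤ 2 * q := by
    by_contra! h
    nlinarith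
  have hfour : ∑ r, ‖fourierSum ψ (indicatorFn S) r‖ ^ 4 ≤ 4 * q ^ 4 := by
    refine (hS.sum_norm_fourierSum_pow_four_le hψ).trans ?_
    rw [← hqsq]
    nlinarith [sq_nonneg q]
  -- On the large spectrum `R` the multiplier is near 1; off it the transform is already small. The
  -- fourth moment bounds `|R|` independently of `F`.
  set R := Finset.univ.filter fun r => η / 2 * q < ‖fourierSum ψ (indicatorFn S) r‖ with hR
  have hRcard : R.card ≤ ⌈64 / η ^ 4⌉₊ := by
    have h1 : R.card • (η / 2 * q) ^ 4 ≤ ∑ r ∈ R, ‖fourierSum ψ (indicatorFn S) r‖ ^ 4 :=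
      Finset.card_nsmul_le_sum _ _ _ fun r hr =>
        pow_le_pow_left₀ (by positivity) (Finset.mem_filter.1 hr).2.le 4
    have h2 : ∑ r ∈ R, ‖fourierSum ψ (indicatorFn S) r‖ ^ 4 ≤ 4 * q ^ 4 :=
      (Finset.sum_le_univ_sum_of_nonneg fun r => by positivity).trans hfour
    have h3 : (R.card : ℝ) ≤ 64 / η ^ 4 := by
      rw [le_div_iff₀ (by positivity)]
      refine le_of_mul_le_mul_right (a := q ^ 4) ?_ (by positivity)
      have h4 := h1.trans h2
      rw [nsmul_eq_mul] at h4
      calc (R.card : ℝ) * η ^ 4 * q ^ 4 = 16 * (R.card * (η / 2 * q) ^ 4) := by ring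
        _ ≤ 64 * q ^ 4 := by linarith
    exact_mod_cast h3.trans (Nat.le_ceil _)
  obtain ⟨B, hB, hBcard, hBR⟩ := hbohr F ψ R
  have hB0 : (0 : ℝ) < B.card := by exact_mod_cast hB.card_pos
  have hBW : q ^ 2 ≤ W * B.card := by
    rw [hqsq]
    exact_mod_cast hBcard.trans (Nat.mul_le_mul_right _ (Nat.pow_le_pow_right hK hRcard))
  have hSB : (S.card : ℝ) / B.card ≤ 1 := by
    rw [div_le_one hB0]
    have : 2 * W * q ≤ W * B.card := by nlinarith
    have : 2 * q ≤ B.card := le_of_mul_le_mul_left (by linarith) hW0R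
    linarith
  have hsmall : ∀ r, ‖fourierSum ψ (indicatorFn S) r‖ * ‖1 - charAverage ψ B r‖ ≤ η * q := by
    intro r
    by_cases hr : r ∈ R
    · have h1 := norm_one_sub_charAverage_le hB fun x hx => hBR x hx r hr
      calc _ ≤ (2 * q) * (η / 2) := mul_le_mul ((norm_fourierSum_indicatorFn_le S r).trans hSq)
            h1 (norm_nonneg _) (by positivity)
        _ = _ := by ring
    · have h1 : ‖fourierSum ψ (indicatorFn S) r‖ ≤ η / 2 * q := by
        simpa [hR] using hr
      have h2 : ‖1 - charAverage ψ B r‖ ≤ 2 := by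
        refine (norm_sub_le _ _).trans ?_
        have := norm_charAverage_le (ψ := ψ) B r
        rw [norm_one]
        linarith
      calc _ ≤ (η / 2 * q) * 2 := mul_le_mul h1 h2 (norm_nonneg _) (by positivity)
        _ = _ := by ring
  have hdiff := abs_sum_prod_sub_sum_prod_le hψ hc (fourierSum_smoothed S B)
    (norm_charAverage_le B) hsmall
  rw [sum_prod_indicatorFn, ← hqsq] at hdiff
  set T := ∑ x : Fin 5 → F with ∑ i, c i * x i = 0, ∏ i, smoothed S B (x i) with hT
  have hdiff' : T - 20 * η * q ^ 3 ≤ (linearSolutions c S).card := by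
    have h1 : q ^ 2 * |((linearSolutions c S).card : ℝ) - T| ≤ q ^ 2 * (20 * η * q ^ 3) := by
      refine hdiff.trans ?_
      calc 5 * (η * q) * ∑ r, ‖fourierSum ψ (indicatorFn S) r‖ ^ 4
          ≤ 5 * (η * q) * (4 * q ^ 4) := mul_le_mul_of_nonneg_left hfour (by positivity)
        _ = _ := by ring
    have h2 := le_of_mul_le_mul_left h1 (by positivity)
    have h3 := (abs_le.1 h2).1
    linarith
  -- Points below this threshold carry mass at most `δq/4`; Cauchy–Schwarz on the remaining mass
  -- bounds `|D|` below.
  set D := Finset.univ.filter fun x => δ / (4 * q) ≤ smoothed S B x with hD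
  have hDcard : δ ^ 2 / 4 * Fintype.card F ≤ D.card := by
    have h1 : ∑ x, smoothed S B x ≤ ∑ x ∈ D, smoothed S B x + δ / 4 * q := by
      rw [← Finset.sum_filter_add_sum_filter_not Finset.univ
        (fun x => δ / (4 * q) ≤ smoothed S B x)]
      refine add_le_add_right ?_ _
      refine (Finset.sum_le_card_nsmul _ _ (δ / (4 * q)) fun x hx =>
        (not_le.1 (Finset.mem_filter.1 hx).2).le).trans ?_
      rw [nsmul_eq_mul]
      calc _ ≤ q ^ 2 * (δ / (4 * q)) := by
            refine mul_le_mul_of_nonneg_right ?_ (by positivity)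
            rw [hqsq]
            exact_mod_cast Finset.card_le_univ _
        _ = _ := by field_simp
    rw [sum_smoothed S hB] at h1
    have h2 : 3 / 4 * δ * q ≤ ∑ x ∈ D, smoothed S B x := by linarith
    have h3 : (∑ x ∈ D, smoothed S B x) ^ 2 ≤ D.card * ∑ x ∈ D, smoothed S B x ^ 2 :=
      sq_sum_le_card_mul_sum_sq
    have h4 : ∑ x ∈ D, smoothed S B x ^ 2 ≤ 2 :=
      (Finset.sum_le_univ_sum_of_nonneg fun x => sq_nonneg _).trans
        ((hS.sum_smoothed_sq_le hB).trans (by linarith))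
    have h5 : (3 / 4 * δ * q) ^ 2 ≤ D.card * 2 :=
      (pow_le_pow_left₀ (by positivity) h2 2).trans
        (h3.trans (mul_le_mul_of_nonneg_left h4 (Nat.cast_nonneg _)))
    rw [← hqsq]
    nlinarith [sq_nonneg (δ * q)]
  have hdense := fiveTermDensity_le_card hc hsum h₀₁ h₂₃ (by positivity) hDcard
  have hTlow : γ * q ^ 3 ≤ T := by
    have h1 : ((linearSolutions c D).card : ℝ) * (δ / (4 * q)) ^ 5 ≤ T := by
      rw [← nsmul_eq_mul]
      refine (Finset.card_nsmul_le_sum _ (fun x : Fin 5 → F => ∏ i, smoothed S B (x i)) _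
        fun x hx => ?_).trans (Finset.sum_le_sum_of_subset_of_nonneg ?_ ?_)
      · have hx' := (mem_linearSolutions.1 hx).1
        calc (δ / (4 * q)) ^ 5 = ∏ _i : Fin 5, δ / (4 * q) := by simp [div_pow]
          _ ≤ _ := Finset.prod_le_prod (fun i _ => by positivity)
            fun i _ => (Finset.mem_filter.1 (hx' i)).2
      · intro x hx
        exact Finset.mem_filter.2 ⟨Finset.mem_univ _, (mem_linearSolutions.1 hx).2⟩
      · exact fun x _ _ => Finset.prod_nonneg fun i _ => smoothed_nonneg S B _
    refine le_trans ?_ h1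
    calc γ * q ^ 3 = κ * (q ^ 2) ^ 4 * (δ / (4 * q)) ^ 5 := by
          rw [hγ]; field_simp
      _ ≤ _ := by
          rw [hqsq]
          exact mul_le_mul_of_nonneg_right hdense (by positivity)
  have hηγ : 20 * η = γ / 2 := by rw [hη]; ring
  rw [hηγ] at hdiff'
  linarith

variable {F : Type} [Field F] [Fintype F] [DecidableEq F] {ψ : AddChar F ℂ}

open Classical in
theorem IsSidonIn.card_not_injective_le (hψ : ψ.IsPrimitive) {S : Finset F} (hS : IsSidonIn S)
    {c : Fin 5 → F} (hc : ∀ i, c i ≠ 0) (hcc : ∀ i j, i ≠ j → c i + c j ≠ 0) :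
    ((linearSolutions c S).filter fun x => ¬ Function.Injective x).card ≤ 40 * S.card ^ 2 := by
  -- Setting `x_j` equal to another variable adds `c j` to that coefficient. The 20 choices, with at
  -- most `2|S|²` solutions each, give 40.
  set c' : Fin 4 × Fin 5 → Fin 4 → F := fun u k =>
    c (u.2.succAbove k) + if k = u.1 then c u.2 else 0 with hc'
  have hsub : ((linearSolutions c S).filter fun x => ¬ Function.Injective x) ⊆
      Finset.univ.biUnion fun u : Fin 4 × Fin 5 => (linearSolutions (c' u) S).image
        fun y => u.2.insertNth (α := fun _ => F) (y u.1) y := by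
    intro x hx
    rw [Finset.mem_filter, mem_linearSolutions] at hx
    obtain ⟨⟨hxS, hx0⟩, hx⟩ := hx
    simp only [Function.Injective, not_forall] at hx
    obtain ⟨i, j, hxij, hij⟩ := hx
    obtain ⟨k, rfl⟩ := Fin.exists_succAbove_eq hij
    refine Finset.mem_biUnion.2 ⟨(k, j), Finset.mem_univ _, Finset.mem_image.2
      ⟨fun l => x (j.succAbove l), mem_linearSolutions.2 ⟨fun l => hxS _, ?_⟩, ?_⟩⟩
    · rw [Fin.sum_univ_succAbove _ j] at hx0
      simp only [hc', add_mul, Finset.sum_add_distrib, ite_mul, zero_mul, Finset.sum_ite_eq',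
        Finset.mem_univ, if_true]
      rw [hxij]
      linear_combination hx0
    · simp only
      rw [hxij]
      exact Fin.insertNth_self_removeNth j x
  have hc0 : ∀ u k, c' u k ≠ 0 := by
    rintro ⟨i, j⟩ k
    simp only [hc']
    split_ifs
    · exact hcc _ _ (Fin.succAbove_ne j k)
    · simpa using hc _
  refine (Finset.card_le_card hsub).trans ((Finset.card_biUnion_le_card_mul _ _ (2 * S.card ^ 2)
    fun u _ => Finset.card_image_le.trans (hS.card_linearSolutions_four_le hψ (hc0 u))).trans
      (le_of_eq ?_))
  simp
  ring

end Transference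

/-! ### Upper bound: reduction to a prime field -/

section UpperBound

/-- The coefficients of the equation, all terms moved to one side. -/
def equationCoeff (a : Fin 4 → ℕ) : Fin 5 → ℤ :=
  ![a 0, a 1, a 2, a 3, -(a 0 + a 1 + a 2 + a 3)]

theorem equationCoeff_ne_zero {a : Fin 4 → ℕ} (ha : ∀ i, 0 < a i) (i : Fin 5) :
    equationCoeff a i ≠ 0 ∧ |equationCoeff a i| ≤ a 0 + a 1 + a 2 + a 3 := by
  have := ha 0; have := ha 1; have := ha 2; have := ha 3
  fin_cases i <;> simp only [equationCoeff, abs_le] <;> simp <;> omega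

theorem equationCoeff_add_ne_zero {a : Fin 4 → ℕ} (ha : ∀ i, 0 < a i) {i j : Fin 5}
    (hij : i ≠ j) : equationCoeff a i + equationCoeff a j ≠ 0 ∧
      |equationCoeff a i + equationCoeff a j| ≤ a 0 + a 1 + a 2 + a 3 := by
  have := ha 0; have := ha 1; have := ha 2; have := ha 3
  fin_cases i <;> fin_cases j <;> first
    | exact absurd rfl hij
    | (simp only [equationCoeff, abs_le]; simp; omega)

theorem intCast_zmod_ne_zero {p : ℕ} {b : ℤ} (hb : b ≠ 0) (hbp : |b| < p) : (b : ZMod p) ≠ 0 := by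
  intro h
  rw [ZMod.intCast_zmod_eq_zero_iff_dvd] at h
  exact hb (Int.eq_zero_of_abs_lt_dvd h hbp)

/-- Both sides of the equation are below `p`, so a congruence is an equality. -/
theorem hasDistinctSolution_of_image {a : Fin 4 → ℕ} {n p : ℕ} [Fact p.Prime] {S : Finset ℕ}
    (hS : S ⊆ Finset.Icc 1 n) (hp : (a 0 + a 1 + a 2 + a 3) * n < p) {x : Fin 5 → ZMod p}
    (hx : x ∈ linearSolutions (fun i => (equationCoeff a i : ZMod p))
      (S.image (Nat.cast : ℕ → ZMod p)))
    (hinj : Function.Injective x) : HasDistinctSolution a S := by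
  rw [mem_linearSolutions] at hx
  obtain ⟨hxS, hx⟩ := hx
  choose s hs hsx using fun i => Finset.mem_image.1 (hxS i)
  refine ⟨s, hs, fun i j hij => hinj (by rw [← hsx, ← hsx, hij]), ?_⟩
  have hsn : ∀ i, s i ≤ n := fun i => (Finset.mem_Icc.1 (hS (hs i))).2
  have hcong : ((a 0 * s 0 + a 1 * s 1 + a 2 * s 2 + a 3 * s 3 : ℕ) : ZMod p) =
      (((a 0 + a 1 + a 2 + a 3) * s 4 : ℕ) : ZMod p) := by
    simp only [Fin.sum_univ_five, equationCoeff, Matrix.cons_val, ← hsx] at hx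
    push_cast at hx ⊢
    linear_combination hx
  rw [ZMod.natCast_eq_natCast_iff', Nat.mod_eq_of_lt, Nat.mod_eq_of_lt] at hcong
  · exact hcong
  · exact (Nat.mul_le_mul_left _ (hsn 4)).trans_lt hp
  · refine lt_of_le_of_lt ?_ hp
    have h0 := Nat.mul_le_mul_left (a 0) (hsn 0)
    have h1 := Nat.mul_le_mul_left (a 1) (hsn 1)
    have h2 := Nat.mul_le_mul_left (a 2) (hsn 2)
    have h3 := Nat.mul_le_mul_left (a 3) (hsn 3)
    linarith

theorem IsSidonSet.image_natCast {n p : ℕ} [Fact p.Prime] {S : Finset ℕ}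
    (hS : IsSidonSet S) (hSn : S ⊆ Finset.Icc 1 n) (hp : 2 * n < p) :
    IsSidonIn (S.image (Nat.cast : ℕ → ZMod p)) := by
  intro x₁ h₁ x₂ h₂ x₃ h₃ x₄ h₄ h
  obtain ⟨s₁, g₁, rfl⟩ := Finset.mem_image.1 h₁
  obtain ⟨s₂, g₂, rfl⟩ := Finset.mem_image.1 h₂
  obtain ⟨s₃, g₃, rfl⟩ := Finset.mem_image.1 h₃
  obtain ⟨s₄, g₄, rfl⟩ := Finset.mem_image.1 h₄
  have b₁ := (Finset.mem_Icc.1 (hSn g₁)).2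
  have b₂ := (Finset.mem_Icc.1 (hSn g₂)).2
  have b₃ := (Finset.mem_Icc.1 (hSn g₃)).2
  have b₄ := (Finset.mem_Icc.1 (hSn g₄)).2
  rw [← Nat.cast_add, ← Nat.cast_add, ZMod.natCast_eq_natCast_iff', Nat.mod_eq_of_lt (by omega),
    Nat.mod_eq_of_lt (by omega)] at h
  rcases hS s₁ g₁ s₂ g₂ s₃ g₃ s₄ g₄ h with ⟨rfl, rfl⟩ | ⟨rfl, rfl⟩
  · exact Or.inl ⟨rfl, rfl⟩
  · exact Or.inr ⟨rfl, rfl⟩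

theorem card_image_natCast {n p : ℕ} {S : Finset ℕ} (hS : S ⊆ Finset.Icc 1 n) (hp : n < p) :
    (S.image (Nat.cast : ℕ → ZMod p)).card = S.card := by
  refine Finset.card_image_of_injOn fun s hs t ht h => ?_
  have b₁ := (Finset.mem_Icc.1 (hS hs)).2
  have b₂ := (Finset.mem_Icc.1 (hS ht)).2
  rwa [ZMod.natCast_eq_natCast_iff', Nat.mod_eq_of_lt (by omega), Nat.mod_eq_of_lt (by omega)] at h

theorem isLittleO_maxAdmissibleSize {a : Fin 4 → ℕ} (ha : ∀ i, 0 < a i) :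
    (fun n : ℕ => (maxAdmissibleSize a n : ℝ)) =o[atTop] fun n : ℕ => Real.sqrt (n : ℝ) := by
  rw [isLittleO_iff]
  intro δ hδ
  set A := a 0 + a 1 + a 2 + a 3 with hA
  have hA4 : 4 ≤ A := by
    have := ha 0; have := ha 1; have := ha 2; have := ha 3
    omega
  have hA0 : (0 : ℝ) < A := by positivity
  -- Since `p ≤ 2An`, size `δ√n` is at least `δ/√(2A)` times `√p`.
  obtain ⟨γ, hγ, q₀, hmain⟩ := IsSidonIn.exists_le_card_linearSolutions
    (δ := δ / √(2 * A)) (by positivity)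
  filter_upwards [eventually_ge_atTop 1, eventually_ge_atTop ⌈(max q₀ (81 / γ)) ^ 2⌉₊]
    with n hn1 hn
  rw [Real.norm_of_nonneg (Nat.cast_nonneg _), Real.norm_of_nonneg (Real.sqrt_nonneg _)]
  by_contra! hlarge
  obtain ⟨S, hSn, hSidon, hSsol, hScard⟩ := (maxAdmissibleSize_isGreatest a n).1
  rw [← hScard] at hlarge
  have hAn : 4 * n ≤ A * n := Nat.mul_le_mul_right n hA4
  have hAA : A ≤ A * n := Nat.le_mul_of_pos_right A hn1
  obtain ⟨p, hp, hAp, hpA⟩ := Nat.exists_prime_lt_and_le_two_mul (A * n) (by omega)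
  have : Fact p.Prime := ⟨hp⟩
  have hcard := hmain (ZMod p) ZMod.stdAddChar (ZMod.isPrimitive_stdAddChar p)
    (fun i => (equationCoeff a i : ZMod p))
  have hlt : ∀ b : ℤ, |b| ≤ a 0 + a 1 + a 2 + a 3 → |b| < p := by
    intro b hb
    have : (A : ℤ) < p := by exact_mod_cast hAA.trans_lt hAp
    rw [hA] at this
    push_cast at this
    linarith
  have hc : ∀ i, (equationCoeff a i : ZMod p) ≠ 0 := fun i =>
    intCast_zmod_ne_zero (equationCoeff_ne_zero ha i).1 (hlt _ (equationCoeff_ne_zero ha i).2)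
  have hcc : ∀ i j, i ≠ j → (equationCoeff a i : ZMod p) + equationCoeff a j ≠ 0 := by
    intro i j hij
    have h := equationCoeff_add_ne_zero ha hij
    exact_mod_cast intCast_zmod_ne_zero h.1 (hlt _ h.2)
  have hsum : ∑ i, (equationCoeff a i : ZMod p) = 0 := by
    simp only [Fin.sum_univ_five, equationCoeff, Matrix.cons_val]
    push_cast
    ring
  have hS' : IsSidonIn (S.image (Nat.cast : ℕ → ZMod p)) := hSidon.image_natCast hSn (by omega)
  have hS'card : (S.image (Nat.cast : ℕ → ZMod p)).card = S.card :=
    card_image_natCast hSn (by omega)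
  have hmax : max q₀ (81 / γ) ≤ √p := by
    refine Real.le_sqrt_of_sq_le ((Nat.le_ceil _).trans ?_)
    exact_mod_cast hn.trans (by omega)
  specialize hcard hc hsum (hcc 0 1 (by decide)) (hcc 2 3 (by decide)) _ hS'
  rw [ZMod.card, hS'card] at hcard
  have hp0 : (0 : ℝ) < √p := Real.sqrt_pos.2 (by exact_mod_cast hp.pos)
  have hsol := hcard ((le_max_left _ _).trans hmax) (by
    refine le_trans ?_ hlarge.le
    have h1 : √(p : ℝ) ≤ √(2 * A) * √n := by
      rw [← Real.sqrt_mul (by positivity)]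
      refine Real.sqrt_le_sqrt ?_
      exact_mod_cast hpA.trans (by rw [mul_assoc])
    calc δ / √(2 * A) * √p ≤ δ / √(2 * A) * (√(2 * A) * √n) :=
          mul_le_mul_of_nonneg_left h1 (by positivity)
      _ = δ * √n := by
          have : √(2 * (A : ℝ)) ≠ 0 := by positivity
          field_simp)
  classical
  have hninj := hS'.card_not_injective_le (ZMod.isPrimitive_stdAddChar p) hc hcc
  have hall : (linearSolutions (fun i => (equationCoeff a i : ZMod p))
      (S.image (Nat.cast : ℕ → ZMod p))).filter (fun x => ¬ Function.Injective x) =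
      linearSolutions (fun i => (equationCoeff a i : ZMod p))
        (S.image (Nat.cast : ℕ → ZMod p)) :=
    Finset.filter_true_of_mem fun x hx hinj =>
      hSsol (hasDistinctSolution_of_image hSn hAp hx hinj)
  have hsq := hS'.sq_card_le
  rw [ZMod.card] at hsq
  have hupper : (linearSolutions (fun i => (equationCoeff a i : ZMod p))
      (S.image (Nat.cast : ℕ → ZMod p))).card ≤ 80 * p := by
    have h : (linearSolutions (fun i => (equationCoeff a i : ZMod p))
      (S.image (Nat.cast : ℕ → ZMod p))).card ≤
        40 * (S.image (Nat.cast : ℕ → ZMod p)).card ^ 2 := by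
      rw [← hall]
      convert hninj
    omega
  -- All solutions are degenerate, so there are at most `40|S|² ≤ 80p`; the requirement `γ√p ≥ 81`
  -- contradicts this.
  have hupper' : γ * √p ^ 3 ≤ 80 * √p ^ 2 := by
    rw [Real.sq_sqrt (Nat.cast_nonneg p)]
    exact hsol.trans (by exact_mod_cast hupper)
  have hγp : 81 ≤ √p * γ := (div_le_iff₀ hγ).1 ((le_max_right _ _).trans hmax)
  have hpsq : 0 < √(p : ℝ) ^ 2 := by positivity
  nlinarith

end UpperBound

theorem mainTheorem7 (a : Fin 4 → ℕ) (ha : ∀ i, 0 < a i) :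
    ((fun n : ℕ => (maxAdmissibleSize a n : ℝ)) =o[atTop] fun n : ℕ => Real.sqrt (n : ℝ)) ∧
    ∃ ε : ℕ → ℝ, Tendsto ε atTop (𝓝 0) ∧
      ∀ n : ℕ, 1 ≤ n → (n : ℝ) ^ ((1 : ℝ) / 2 - ε n) ≤ (maxAdmissibleSize a n : ℝ) :=
  ⟨isLittleO_maxAdmissibleSize ha, exists_exponent_maxAdmissibleSize ha⟩
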